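/- **Notation.** For $s>0$ and $\vec x\in\mathbb R^n$ let $\rho_s(\vec x)=\exp(-\pi\|\vec x\|^2/s^2)$, and $\rho_s(A)=\sum_{\vec x\in A}\rho_s(\vec x)$ for a set $A$ of vectors. For a (full-rank) lattice $\mathcal L\subset\mathbb R^n$ and a shift $\vec t\in\mathbb R^n$, $D_{\mathcal L-\vec t,s}$ is the distribution on $\mathcal L-\vec t$ that gives $\vec x$ probability $\rho_s(\vec x)/\rho_s(\mathcal L-\vec t)$; $D_{2\mathcal L+\vec c,s}$ is defined in the same way on the coset $2\mathcal L+\vec c$. *Pair-and-average* takes a finite list of vectors of $\mathcal L-\vec t$ and goes through it from left to right: each vector $\vec X_i$ that is still unpaired is paired with the first later unpaired $\vec X_j$ with $\vec X_j\equiv\vec X_i \bmod 2\mathcal L$, and $(\vec X_i+\vec X_j)/2$ is added to the output; if there is no such $\vec X_j$, then $\vec X_i$ is dropped. A random finite list of vectors of $\mathcal L-\vec t$ (possibly of random length) is a *mixture of independent Gaussians over $\mathcal L-\vec t$ with parameter $s$* if, conditioned on any list $(\vec c_1,\dots,\vec c_m)$ of cosets mod $2\mathcal L$ of its entries that has positive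 probability, its entries are independent and the $i$-th one is distributed as $D_{2\mathcal L+\vec c_i,s}$. Such a mixture $\mathcal M$ *dominates* another, $\mathcal M'$, if for every choice of multiplicities $k_{\vec c}\in\mathbb N$, $\vec c\in(\mathcal L-\vec t)/(2\mathcal L)$, the probability that, for all $\vec c$, at least $k_{\vec c}$ entries lie in $\vec c$ is at least as large for $\mathcal M$ as for $\mathcal M'$. **Statement.** There are universal constants $C,c>0$ such that the following holds for every $n$, every lattice $\mathcal L\subset\mathbb R^n$, shift $\vec t\in\mathbb R^n$, parameter $s>0$, integers $M\ge 2$ and $\ell\ge 1$, and every real $\kappa\ge C\log M$ with $$M\ \ge\ (10\kappa)^{2\ell}\cdot\frac{\rho_s(\mathcal L-\vec t)}{\max_{\vec c\in\mathcal L/(2\mathcal L)}\rho_s(2\mathcal L+\vec c-\vec t)} .$$ Let $\mathcal O$ be the result of applying pair-and-average $\ell$ times to $M$ independent samples from $D_{\mathcal L-\vec t,s}$, and let $\mathcal T$ be a list of $$M'=\left\lceil \frac{M}{(32\kappa)^\ell}\cdot\prod_{i=0}^{\ell-1}\frac{\rho_{s/2^{(i+1)/2}}(\mathcal L-\vec t)\,\rho_{s/2^{(i+1)/2}}(\mathcal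 L)}{\rho_{s/2^{i/2}}(\mathcal L-\vec t)\cdot\max_{\vec c\in\mathcal L/(2\mathcal L)}\rho_{s/2^{i/2}}(2\mathcal L+\vec c-\vec t)}\right\rceil$$ independent samples from $D_{\mathcal L-\vec t,\,s/2^{\ell/2}}$. Then $\mathcal O$ is a mixture of independent Gaussians over $\mathcal L-\vec t$ with parameter $s/2^{\ell/2}$, and it dominates $\mathcal T$ up to statistical distance $\ell\exp(-c\kappa)$, in both of the following senses: 1. there is a mixture $\mathcal O'$ of independent Gaussians over $\mathcal L-\vec t$ with parameter $s/2^{\ell/2}$, at statistical distance at most $\ell\exp(-c\kappa)$ from $\mathcal O$, that dominates $\mathcal T$; 2. there is a mixture $\mathcal T'$ of independent Gaussians over $\mathcal L-\vec t$ with parameter $s/2^{\ell/2}$, at statistical distance at most $\ell\exp(-c\kappa)$ from $\mathcal T$, that is dominated by $\mathcal O$. -/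

import Mathlib

open scoped ENNReal Pointwise

/-- `ℝⁿ` with the Euclidean norm. -/
abbrev Vec (n : ℕ) : Type := EuclideanSpace ℝ (Fin n)

noncomputable section

/-! ### Gaussian mass and the discrete Gaussian -/

/-- The Gaussian mass `ρ_s(x) = exp(-π ‖x‖² / s²)` of a vector. -/
def gaussianMass {n : ℕ} (s : ℝ) (x : Vec n) : ℝ :=
  Real.exp (-Real.pi * ‖x‖ ^ 2 / s ^ 2)

/-- The Gaussian mass `ρ_s(A) = ∑_{x ∈ A} ρ_s(x)` of a set of vectors. The sum converges for every
subset of a shifted lattice, see `summable_gaussianMass`. -/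
def gaussianMassSet {n : ℕ} (s : ℝ) (A : Set (Vec n)) : ℝ :=
  ∑' x : A, gaussianMass s (x : Vec n)

open Classical in
/-- The discrete Gaussian distribution `D_{A,s}` on a set `A` (a shifted lattice), which gives
`x ∈ A` probability `ρ_s(x) / ρ_s(A)`, see `discreteGaussian_apply`. If the total mass is zero or
infinite (never the case for a shifted lattice and `s > 0`), the value is a dummy. -/
def discreteGaussian {n : ℕ} (s : ℝ) (A : Set (Vec n)) : PMF (Vec n) :=
  if h : (∑' x, A.indicator (fun y => ENNReal.ofReal (gaussianMass s y)) x) ≠ 0 ∧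
      (∑' x, A.indicator (fun y => ENNReal.ofReal (gaussianMass s y)) x) ≠ ∞ then
    PMF.normalize (A.indicator fun y => ENNReal.ofReal (gaussianMass s y)) h.1 h.2
  else PMF.pure 0

/-- The shifted lattice `L - t`. -/
def shiftedLattice {n : ℕ} (L : Submodule ℤ (Vec n)) (t : Vec n) : Set (Vec n) :=
  {x | x + t ∈ L}

/-- The sublattice `2L` of `L`. -/
def doubleLattice {n : ℕ} (L : Submodule ℤ (Vec n)) : Submodule ℤ (Vec n) :=
  (2 : ℤ) • L

/-- The coset `2L + x` of a vector `x`. -/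
def cosetOf {n : ℕ} (L : Submodule ℤ (Vec n)) (x : Vec n) : Vec n ⧸ doubleLattice L :=
  Submodule.Quotient.mk x

/-- A coset of `2L`, as a set of vectors. -/
def cosetSet {n : ℕ} (L : Submodule ℤ (Vec n)) (q : Vec n ⧸ doubleLattice L) : Set (Vec n) :=
  {x | cosetOf L x = q}

/-- `max_{c ∈ L/(2L)} ρ_s(2L + c - t)`. The coset `c` ranges over representatives in `L`; only
finitely many values occur, so that the supremum is a maximum. -/
def maxCosetMass {n : ℕ} (L : Submodule ℤ (Vec n)) (t : Vec n) (s : ℝ) : ℝ :=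
  ⨆ c : L, gaussianMassSet s (cosetSet L (cosetOf L ((c : Vec n) - t)))

/-! ### Random lists -/

/-- The list of independent samples, one from each of the given distributions. -/
def independentList {α : Type*} : List (PMF α) → PMF (List α)
  | [] => PMF.pure []
  | p :: ps => p.bind fun x => (independentList ps).map fun l => x :: l

/-- `M` independent samples from `p`. -/
def iidList {α : Type*} (M : ℕ) (p : PMF α) : PMF (List α) :=
  independentList (List.replicate M p)

open Classical in
/-- The random list `μ` dominates the random list `ν`: for all multiplicities `k`, it is at least as
likely under `μ` as under `ν` that the list contains every `a` at least `k a` times.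
(`p.toOuterMeasure S` is the probability of the event `S`.) -/
def Dominates {α : Type*} (μ ν : PMF (List α)) : Prop :=
  ∀ k : α → ℕ,
    ν.toOuterMeasure {l | ∀ a, k a ≤ l.count a} ≤ μ.toOuterMeasure {l | ∀ a, k a ≤ l.count a}

/-- Statistical distance (total variation distance) of two discrete distributions. -/
def statDist {α : Type*} (μ ν : PMF α) : ℝ :=
  (1 / 2) * ∑' a, |(μ a).toReal - (ν a).toReal|

/-! ### Mixtures of independent Gaussians -/

/-- The coset distribution of a random list of vectors: the random list of their cosets mod `2L`. -/
def cosetDistribution {n : ℕ} (L : Submodule ℤ (Vec n)) (μ : PMF (List (Vec n))) :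
    PMF (List (Vec n ⧸ doubleLattice L)) :=
  μ.map (List.map (cosetOf L))

/-- The random list `μ` is a mixture of independent Gaussians over `L - t` with parameter `s`:
its entries lie in `L - t` and, conditioned on any list of cosets `c₁, …, c_M` mod `2L` of positive
probability, its entries are independent, the `i`-th one distributed as the discrete Gaussian on
the coset `cᵢ` with parameter `s`. -/
structure IsGaussianMixture {n : ℕ} (L : Submodule ℤ (Vec n)) (t : Vec n) (s : ℝ)
    (μ : PMF (List (Vec n))) : Prop where
  mem_shiftedLattice : ∀ l ∈ μ.support, ∀ x ∈ l, x ∈ shiftedLattice L t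
  filter_eq : ∀ (c : List (Vec n ⧸ doubleLattice L))
    (h : ∃ l ∈ {l : List (Vec n) | l.map (cosetOf L) = c}, l ∈ μ.support),
    μ.filter {l | l.map (cosetOf L) = c} h =
      independentList (c.map fun q => discreteGaussian s (cosetSet L q))

open Classical in
/-- The pair-and-average procedure: go through the list from left to right; if there is a later,
still unpaired vector in the same coset mod `2L` as the current unpaired vector, pair it with the
first such vector and output their average, and otherwise drop it. -/
def pairAndAverage {n : ℕ} (L : Submodule ℤ (Vec n)) : List (Vec n) → List (Vec n)
  | [] => []
  | x :: l =>
    match l.find? (fun y => cosetOf L y = cosetOf L x) with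
    | some y =>
      (1 / 2 : ℝ) • (x + y) :: pairAndAverage L (l.eraseP fun y => cosetOf L y = cosetOf L x)
    | none => pairAndAverage L l
termination_by l => l.length
decreasing_by
  · exact Nat.lt_succ_of_le List.length_eraseP_le
  · exact Nat.lt_succ_self _

/-! ### The number of samples -/

/-- The ratio `ρ_{s'}(L - t) ρ_{s'}(L) / (ρ_s(L - t) · max_{c ∈ L/(2L)} ρ_s(2L + c - t))`. -/
def massRatio {n : ℕ} (L : Submodule ℤ (Vec n)) (t : Vec n) (s s' : ℝ) : ℝ :=
  (gaussianMassSet s' (shiftedLattice L t) * gaussianMassSet s' (L : Set (Vec n))) /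
    (gaussianMassSet s (shiftedLattice L t) * maxCosetMass L t s)

/-- `M' = ⌈M / (32κ)^ℓ · ∏_{i=0}^{ℓ-1} r_i⌉`, where `r_i` is the mass ratio for `s / 2^{i/2}` and
`s' = s / 2^{(i+1)/2}`. -/
def outputCount {n : ℕ} (L : Submodule ℤ (Vec n)) (t : Vec n) (s κ : ℝ) (M ℓ : ℕ) : ℕ :=
  ⌈(M : ℝ) / (32 * κ) ^ ℓ * ∏ i ∈ Finset.range ℓ,
    massRatio L t (s / 2 ^ ((i : ℝ) / 2)) (s / 2 ^ (((i : ℝ) + 1) / 2))⌉₊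

/-! ### The discrete Gaussian is well defined -/

theorem summable_gaussianMass {n : ℕ} (L : Submodule ℤ (Vec n)) [DiscreteTopology L]
    (t : Vec n) {s : ℝ} (hs : 0 < s) {A : Set (Vec n)} (hA : A ⊆ shiftedLattice L t) :
    Summable fun x : A => gaussianMass s (x : Vec n) := by
  classical
  have key : Summable fun z : L => gaussianMass s ((z : Vec n) - t) := by
    set d := Module.finrank ℤ L + 1 with hd
    set a : ℝ := Real.pi / s ^ 2 with ha
    have ha0 : 0 < a := by positivity
    have h1 : Summable fun z : L => ‖(z : Vec n) - t‖⁻¹ ^ (2 * d) :=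
      ZLattice.summable_norm_sub_inv_pow L (2 * d) (by omega) t
    have h2 : Summable fun z : L => if (z : Vec n) = t then (1 : ℝ) else 0 := by
      refine summable_of_hasFiniteSupport ((Set.subsingleton_of_forall_eq
        (s := Function.support fun z : L => if (z : Vec n) = t then (1 : ℝ) else 0)
        (a := if h : t ∈ L then ⟨t, h⟩ else 0) ?_).finite)
      intro z hz
      have hzt : (z : Vec n) = t := by
        by_contra h
        simp [h] at hz
      have ht : t ∈ L := hzt ▸ z.2
      rw [dif_pos ht]
      exact Subtype.ext hzt
    refine Summable.of_nonneg_of_le (fun z => (Real.exp_pos _).le) (fun z => ?_)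
      ((h1.mul_left ((d.factorial : ℝ) / a ^ d)).add h2)
    by_cases hz : (z : Vec n) = t
    · simp [gaussianMass, hz]
    · have hr : 0 < ‖(z : Vec n) - t‖ := norm_pos_iff.2 (sub_ne_zero.2 hz)
      simp only [hz, if_false, add_zero, gaussianMass]
      set r := ‖(z : Vec n) - t‖
      have hx : -Real.pi * r ^ 2 / s ^ 2 = -(a * r ^ 2) := by rw [ha]; ring
      have h3 := Real.pow_div_factorial_le_exp (a * r ^ 2) (by positivity) d
      rw [hx, Real.exp_neg]
      refine (inv_anti₀ (by positivity) h3).trans (le_of_eq ?_)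
      rw [mul_pow, ← pow_mul, inv_pow]
      field_simp
  have hinj : Function.Injective fun x : A => (⟨(x : Vec n) + t, hA x.2⟩ : L) := by
    intro x y h
    exact Subtype.ext (add_right_cancel (congrArg Subtype.val h))
  have := key.comp_injective hinj
  simpa [Function.comp_def] using this

/-- On a non-empty subset of a shifted lattice (such as `L - t`, or a coset of `2L` in it) the
discrete Gaussian has the defining probabilities. -/
theorem discreteGaussian_apply {n : ℕ} (L : Submodule ℤ (Vec n)) [DiscreteTopology L]
    (t : Vec n) {s : ℝ} (hs : 0 < s) {A : Set (Vec n)} (hA : A ⊆ shiftedLattice L t)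
    {x : Vec n} (hx : x ∈ A) :
    discreteGaussian s A x = ENNReal.ofReal (gaussianMass s x / gaussianMassSet s A) := by
  have hsum := summable_gaussianMass L t hs hA
  have hpos : ∀ y : Vec n, 0 < gaussianMass s y := fun y => Real.exp_pos _
  have htot : (∑' y, A.indicator (fun y => ENNReal.ofReal (gaussianMass s y)) y) =
      ENNReal.ofReal (gaussianMassSet s A) := by
    rw [← tsum_subtype A fun y => ENNReal.ofReal (gaussianMass s y), gaussianMassSet,
      ENNReal.ofReal_tsum_of_nonneg (fun y => (hpos _).le) hsum]
  have hmass : 0 < gaussianMassSet s A :=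
    hsum.tsum_pos (fun y => (hpos _).le) ⟨x, hx⟩ (hpos _)
  have h : (∑' y, A.indicator (fun y => ENNReal.ofReal (gaussianMass s y)) y) ≠ 0 ∧
      (∑' y, A.indicator (fun y => ENNReal.ofReal (gaussianMass s y)) y) ≠ ∞ := by
    rw [htot]
    exact ⟨by simpa using hmass, ENNReal.ofReal_ne_top⟩
  rw [discreteGaussian, dif_pos h, PMF.normalize_apply, htot, Set.indicator_of_mem hx,
    ENNReal.ofReal_div_of_pos hmass, div_eq_mul_inv]

end

/-! Put s' = s / √2. By the parallelogram law ρ_s(y + z) ρ_s(y - z) = ρ_{s'}(y) ρ_{s'}(z), and y +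
z, y - z both lie in a coset q of 2L exactly when z ∈ L and y + z ∈ q. So the average y of two
independent Gaussian samples from q has probability ρ_{s'}(y) times a factor that depends only on q
and on the coset of y (`averageLaw_cosetGaussian_apply`): it is again a mixture of coset Gaussians.
As pairing looks only at cosets, the procedure reduces to a random evolution of lists of cosets
(`map_pairAndAverage_mixtureOf`), and only such lists have to be compared.

Let p be the coset law of D_{L-t,s} and S = ∑ p². If q is drawn from p² / S, the normalisers of the
cosets cancel and the average is exactly D_{L-t,s'} (`bind_squaredLaw_aux`). One round thus works if
the pairs formed from N samples of p contain N' independent samples of p² / S, up to small error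
(`coupledUpTo_iidList`). For this both lengths are replaced by Poisson variables, which makes the
multiplicities of the cosets independent Poisson variables (`poissonList_map_countVec`). In each
coset, twice a Poisson variable of mean μ must fit below one of mean λ (`coupledUpTo_poisson`):
tails are compared for small λ and Chernoff bounds used for large λ. The error per coset is
proportional to λ and μ, so the union bound costs a factor of order N, not the number of cosets.

The rounds compose because pairing and drawing new cosets both respect inclusion of multisets
(`coupledUpTo_roundCosets`). The hypothesis needed in each round, that N times the largest coset
probability is at least (10κ)², persists: `maxCosetProb_le_massRatio_mul` shows that this product
drops by at most 32κ ≤ (10κ)² per round. Finally, altering an approximate coupling on its bad event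
gives a law at small statistical distance with an exact coupling, hence domination
(`CoupledUpTo.exists_left`). -/

noncomputable section

/-! ### Independent lists -/

section IndependentList

variable {α β γ : Type*}

theorem independentList_nil : independentList ([] : List (PMF α)) = PMF.pure [] := rfl

theorem independentList_cons (p : PMF α) (ps : List (PMF α)) :
    independentList (p :: ps) = p.bind fun x => (independentList ps).bind fun l =>
      PMF.pure (x :: l) := rfl

theorem independentList_append (ps qs : List (PMF α)) :
    independentList (ps ++ qs) = (independentList ps).bind fun l => (independentList qs).bind
      fun l' => PMF.pure (l ++ l') := by
  induction ps with
  | nil => simp [independentList_nil]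
  | cons p ps ih => simp [independentList_cons, ih]

/-- Two-stage sampling can be done entry by entry or stage by stage. This separates drawing the
cosets from drawing the vectors inside them. -/
theorem independentList_map_bind {ι : Type*} (p : ι → PMF β) (k : β → PMF γ) (l : List ι) :
    independentList (l.map fun i => (p i).bind k) =
      (independentList (l.map p)).bind fun l' => independentList (l'.map k) := by
  induction l with
  | nil => simp [independentList_nil]
  | cons i l ih =>
    simp only [List.map_cons, independentList_cons, ih, PMF.bind_bind, PMF.pure_bind]
    congr 1; funext x
    rw [PMF.bind_comm]

theorem independentList_map_map {ι : Type*} (p : ι → PMF β) (f : β → γ) (l : List ι) :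
    independentList (l.map fun i => (p i).map f) =
      (independentList (l.map p)).map (List.map f) := by
  induction l with
  | nil => simp [independentList_nil, PMF.pure_map]
  | cons i l ih =>
    simp only [List.map_cons, independentList_cons, ih, PMF.map_bind, PMF.bind_map, PMF.pure_map,
      Function.comp_def]

theorem mem_support_independentList {ps : List (PMF α)} {l : List α}
    (h : l ∈ (independentList ps).support) :
    List.Forall₂ (fun x p => x ∈ PMF.support p) l ps := by
  induction ps generalizing l with
  | nil =>
    simp [independentList_nil] at h
    simp [h]
  | cons p ps ih =>
    rw [independentList_cons, PMF.mem_support_bind_iff] at h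
    obtain ⟨x, hx, h⟩ := h
    rw [PMF.mem_support_bind_iff] at h
    obtain ⟨l', hl', h⟩ := h
    rw [PMF.mem_support_pure_iff] at h
    subst h
    exact List.Forall₂.cons hx (ih hl')

theorem iidList_zero (p : PMF α) : iidList 0 p = PMF.pure [] := rfl

theorem iidList_succ (M : ℕ) (p : PMF α) :
    iidList (M + 1) p = p.bind fun x => (iidList M p).bind fun l => PMF.pure (x :: l) := rfl

theorem iidList_bind (M : ℕ) (p : PMF α) (k : α → PMF β) :
    iidList M (p.bind k) = (iidList M p).bind fun l => independentList (l.map k) := by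
  have := independentList_map_bind (fun _ : Unit => p) k (List.replicate M ())
  simpa [iidList] using this

theorem iidList_map (M : ℕ) (p : PMF α) (f : α → β) :
    iidList M (p.map f) = (iidList M p).map (List.map f) := by
  have := independentList_map_map (fun _ : Unit => p) f (List.replicate M ())
  simpa [iidList] using this

theorem mem_support_iidList {M : ℕ} {p : PMF α} {l : List α}
    (h : l ∈ (iidList M p).support) : l.length = M ∧ ∀ x ∈ l, x ∈ p.support := by
  have h' := mem_support_independentList h
  refine ⟨by simpa using h'.length_eq, fun x hx => ?_⟩
  obtain ⟨i, hi, rfl⟩ := List.mem_iff_getElem.1 hx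
  have := h'.get (i := i) hi (by simpa [h'.length_eq] using hi)
  simpa using this

theorem PMF.bind_congr' {p : PMF α} {f g : α → PMF β} (h : ∀ a ∈ p.support, f a = g a) :
    p.bind f = p.bind g := by
  ext b
  simp only [PMF.bind_apply]
  refine tsum_congr fun a => ?_
  by_cases ha : p a = 0
  · simp [ha]
  · rw [h a ha]

theorem PMF.map_congr' {p : PMF α} {f g : α → β} (h : ∀ a ∈ p.support, f a = g a) :
    p.map f = p.map g :=
  PMF.bind_congr' fun a ha => by simp [h a ha]

end IndependentList

/-! ### Disintegration -/

section Coupling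

variable {α β γ δ : Type*}

/-- The kernel is the conditional law of `μ` on a fibre of `f`. It serves to glue couplings along a
common marginal. -/
theorem PMF.exists_disintegration (μ : PMF α) (f : α → β) :
    ∃ k : β → PMF α, (μ.map f).bind k = μ ∧
      ∀ b ∈ (μ.map f).support, ∀ a ∈ (k b).support, f a = b := by
  classical
  obtain ⟨a₀, -⟩ := μ.support_nonempty
  have hex : ∀ b, b ∈ (μ.map f).support → ∃ a ∈ {a | f a = b}, a ∈ μ.support := by
    intro b hb
    obtain ⟨a, ha, h⟩ := (PMF.mem_support_map_iff _ _ _).1 hb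
    exact ⟨a, h, ha⟩
  refine ⟨fun b => if h : b ∈ (μ.map f).support then μ.filter {a | f a = b} (hex b h)
    else PMF.pure a₀, ?_, ?_⟩
  · ext a
    rw [PMF.bind_apply, tsum_eq_single (f a)]
    · by_cases ha : a ∈ μ.support
      · have hb : f a ∈ (μ.map f).support := (PMF.mem_support_map_iff _ _ _).2 ⟨a, ha, rfl⟩
        have hmass : (μ.map f) (f a) = ∑' x, ({x | f x = f a} : Set α).indicator μ x := by
          rw [PMF.map_apply]
          refine tsum_congr fun x => ?_
          by_cases hx : f x = f a
          · simp [hx]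
          · simp [hx, Ne.symm hx]
        rw [dif_pos hb, PMF.filter_apply, ← hmass, Set.indicator_of_mem (by simp), mul_comm,
          mul_assoc, ENNReal.inv_mul_cancel hb ((μ.map f).apply_ne_top _), mul_one]
      · have h0 : μ a = 0 := (PMF.apply_eq_zero_iff _ _).2 ha
        rw [h0]
        split_ifs with h
        · rw [PMF.filter_apply]
          simp [Set.indicator, h0]
        · rw [(PMF.apply_eq_zero_iff _ _).2 h, zero_mul]
    · intro b hb
      split_ifs with h
      · rw [PMF.filter_apply_eq_zero_of_notMem, mul_zero]
        exact fun h' => hb h'.symm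
      · rw [(PMF.apply_eq_zero_iff _ _).2 h, zero_mul]
  · intro b hb a ha
    simp only [hb, dif_pos] at ha
    exact ((PMF.mem_support_filter_iff _).1 ha).1

/-! ### Approximate couplings -/

/-- `μ` and `ν` have a coupling that satisfies the relation `R` up to an event of probability at
most `ε`. -/
def CoupledUpTo (ε : ℝ≥0∞) (R : α → β → Prop) (μ : PMF α) (ν : PMF β) : Prop :=
  ∃ J : PMF (α × β), J.map Prod.fst = μ ∧ J.map Prod.snd = ν ∧
    J.toOuterMeasure {x | ¬ R x.1 x.2} ≤ ε

theorem CoupledUpTo.mono {ε ε' : ℝ≥0∞} {R R' : α → β → Prop} {μ : PMF α} {ν : PMF β}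
    (h : CoupledUpTo ε R μ ν) (hε : ε ≤ ε') (hR : ∀ a b, R a b → R' a b) :
    CoupledUpTo ε' R' μ ν := by
  obtain ⟨J, h1, h2, h3⟩ := h
  exact ⟨J, h1, h2,
    (MeasureTheory.measure_mono fun x (hx : ¬ _) h => hx (hR _ _ h)).trans (h3.trans hε)⟩

theorem CoupledUpTo.of_map {ε : ℝ≥0∞} {R : α → β → Prop} (J : PMF γ) (f : γ → α) (g : γ → β)
    (h : J.toOuterMeasure {x | ¬ R (f x) (g x)} ≤ ε) : CoupledUpTo ε R (J.map f) (J.map g) := by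
  refine ⟨J.map fun x => (f x, g x), ?_, ?_, ?_⟩
  · rw [PMF.map_comp]; rfl
  · rw [PMF.map_comp]; rfl
  · rw [PMF.toOuterMeasure_map_apply]; exact h

theorem CoupledUpTo.refl {R : α → α → Prop} (hR : ∀ a, R a a) (μ : PMF α) :
    CoupledUpTo 0 R μ μ := by
  have := CoupledUpTo.of_map (ε := 0) (R := R) μ id id (by simp [hR])
  simpa [PMF.map_id] using this

theorem CoupledUpTo.map {ε : ℝ≥0∞} {R : α → β → Prop} {R' : γ → δ → Prop} {μ : PMF α} {ν : PMF β}
    (h : CoupledUpTo ε R μ ν) {f : α → γ} {g : β → δ} (hfg : ∀ a b, R a b → R' (f a) (g b)) :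
    CoupledUpTo ε R' (μ.map f) (ν.map g) := by
  obtain ⟨J, rfl, rfl, h3⟩ := h
  rw [PMF.map_comp, PMF.map_comp]
  exact CoupledUpTo.of_map J _ _
    ((MeasureTheory.measure_mono fun x (hx : ¬ _) h => hx (hfg _ _ h)).trans h3)

/-- On pairs related by `R` the exact couplings of the kernels are used, on the others the
independent one. So only the bad event of the first stage contributes to the error. -/
theorem CoupledUpTo.bind {ε : ℝ≥0∞} {R : α → β → Prop} {R' : γ → δ → Prop} {μ : PMF α} {ν : PMF β}
    (h : CoupledUpTo ε R μ ν) {f : α → PMF γ} {g : β → PMF δ}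
    (hfg : ∀ a b, R a b → CoupledUpTo 0 R' (f a) (g b)) :
    CoupledUpTo ε R' (μ.bind f) (ν.bind g) := by
  classical
  obtain ⟨J, rfl, rfl, h3⟩ := h
  have key : ∀ x : α × β, ∃ K : PMF (γ × δ), K.map Prod.fst = f x.1 ∧ K.map Prod.snd = g x.2 ∧
      (R x.1 x.2 → K.toOuterMeasure {y | ¬ R' y.1 y.2} = 0) := by
    intro x
    by_cases hx : R x.1 x.2
    · obtain ⟨K, h1, h2, h3⟩ := hfg _ _ hx
      exact ⟨K, h1, h2, fun _ => le_antisymm h3 zero_le⟩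
    · refine ⟨(f x.1).bind fun c => (g x.2).bind fun d => PMF.pure (c, d), ?_, ?_,
        fun h => absurd h hx⟩
      · simp [PMF.map_bind, PMF.pure_map]
      · simp [PMF.map_bind, PMF.pure_map]
  choose K hK1 hK2 hK3 using key
  refine ⟨J.bind K, ?_, ?_, ?_⟩
  · simp [PMF.map_bind, PMF.bind_map, hK1, Function.comp_def]
  · simp [PMF.map_bind, PMF.bind_map, hK2, Function.comp_def]
  · refine le_trans ?_ h3
    rw [PMF.toOuterMeasure_bind_apply, PMF.toOuterMeasure_apply]
    refine ENNReal.tsum_le_tsum fun x => ?_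
    by_cases hx : R x.1 x.2
    · simp [hK3 x hx]
    · rw [Set.indicator_of_mem (by exact hx)]
      calc _ ≤ J x * 1 := by
            gcongr
            exact (MeasureTheory.measure_mono (Set.subset_univ _)).trans
              (((K x).toOuterMeasure_apply_eq_one_iff _).2 (Set.subset_univ _)).le
        _ = J x := mul_one _

/-- Gluing: given the first coupling, the second is drawn conditionally on the shared middle
coordinate, and the two bad events are united. -/
theorem CoupledUpTo.trans {ε ε' : ℝ≥0∞} {R : α → β → Prop} {R' : β → γ → Prop} {S : α → γ → Prop}
    {μ : PMF α} {ν : PMF β} {ξ : PMF γ} (h : CoupledUpTo ε R μ ν) (h' : CoupledUpTo ε' R' ν ξ)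
    (hS : ∀ a b c, R a b → R' b c → S a c) : CoupledUpTo (ε + ε') S μ ξ := by
  obtain ⟨J, rfl, hJ, h3⟩ := h
  obtain ⟨J', hJ', rfl, h3'⟩ := h'
  obtain ⟨k, hk, hk'⟩ := J'.exists_disintegration Prod.fst
  rw [hJ', ← hJ] at hk hk'
  let K : PMF ((α × β) × (β × γ)) := J.bind fun x => (k x.2).bind fun y => PMF.pure (x, y)
  have hK1 : K.map Prod.fst = J := by
    simp [K, PMF.map_bind, PMF.pure_map]
  have hK2 : K.map Prod.snd = J' := by
    conv_rhs => rw [← hk]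
    simp [K, PMF.map_bind, PMF.pure_map, PMF.bind_map, Function.comp_def]
  have hKs : ∀ z ∈ K.support, z.2.1 = z.1.2 := by
    intro z hz
    obtain ⟨x, hx, hz⟩ := (PMF.mem_support_bind_iff _ _ _).1 hz
    obtain ⟨y, hy, hz⟩ := (PMF.mem_support_bind_iff _ _ _).1 hz
    rw [PMF.mem_support_pure_iff] at hz
    subst hz
    exact hk' x.2 ((PMF.mem_support_map_iff _ _ _).2 ⟨x, hx, rfl⟩) y hy
  have e1 : J.map Prod.fst = K.map fun z => z.1.1 := by
    rw [← hK1, PMF.map_comp]; rfl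
  have e2 : J'.map Prod.snd = K.map fun z => z.2.2 := by
    rw [← hK2, PMF.map_comp]; rfl
  rw [e1, e2]
  refine CoupledUpTo.of_map K _ _ ?_
  calc K.toOuterMeasure {z | ¬ S z.1.1 z.2.2}
      ≤ K.toOuterMeasure ({z | ¬ R z.1.1 z.1.2} ∪ {z | ¬ R' z.2.1 z.2.2}) := by
        refine PMF.toOuterMeasure_mono _ fun z hz => ?_
        by_contra hcon
        simp only [Set.mem_union, Set.mem_ofPred_eq, not_or, not_not] at hcon
        refine hz.1 (hS _ _ _ hcon.1 ?_)
        rw [← hKs z hz.2]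
        exact hcon.2
    _ ≤ K.toOuterMeasure {z | ¬ R z.1.1 z.1.2} + K.toOuterMeasure {z | ¬ R' z.2.1 z.2.2} :=
        MeasureTheory.measure_union_le _ _
    _ ≤ ε + ε' := by
        refine add_le_add ?_ ?_
        · rw [← hK1, PMF.toOuterMeasure_map_apply] at h3
          exact h3
        · rw [← hK2, PMF.toOuterMeasure_map_apply] at h3'
          exact h3'

/-- A coupling of the images lifts to a coupling. -/
theorem CoupledUpTo.of_map_map {ε : ℝ≥0∞} {R : γ → δ → Prop} {μ : PMF α} {ν : PMF β}
    {f : α → γ} {g : β → δ} (h : CoupledUpTo ε R (μ.map f) (ν.map g)) :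
    CoupledUpTo ε (fun a b => R (f a) (g b)) μ ν := by
  -- The graphs of `f` and `g` are exact couplings, which are glued to the given one on both sides.
  have h1 : CoupledUpTo 0 (fun a c => f a = c) μ (μ.map f) := by
    simpa [PMF.map_id] using
      CoupledUpTo.of_map (ε := 0) (R := fun a c => f a = c) μ id f (by simp)
  have h2 : CoupledUpTo 0 (fun d b => g b = d) (ν.map g) ν := by
    simpa [PMF.map_id] using
      CoupledUpTo.of_map (ε := 0) (R := fun d b => g b = d) ν g id (by simp)
  have := (h1.trans h (S := fun a d => R (f a) d) (by rintro a b c rfl h; exact h)).trans h2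
    (S := fun a b => R (f a) (g b)) (by rintro a b c h rfl; exact h)
  simpa using this

/-! ### Subpermutations of independent lists -/

theorem coupledUpTo_independentList_perm {ps qs : List (PMF α)} (h : ps.Perm qs) :
    CoupledUpTo 0 List.Perm (independentList ps) (independentList qs) := by
  induction h with
  | nil => exact CoupledUpTo.refl List.Perm.refl _
  | cons p _ ih =>
    exact (CoupledUpTo.refl (R := Eq) (fun _ => rfl) p).bind fun a b hab => by
      subst hab
      exact ih.map fun l l' h => h.cons a
  | swap p q l =>
    -- Both lists are functions of the same triple of samples, which differ only in the order of the
    -- first two entries.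
    have e1 : independentList (q :: p :: l) =
        (q.bind fun y => p.bind fun x => (independentList l).bind fun l =>
          PMF.pure (x, y, l)).map fun z => z.2.1 :: z.1 :: z.2.2 := by
      simp [independentList_cons, PMF.map_bind, PMF.pure_map]
    have e2 : independentList (p :: q :: l) =
        (q.bind fun y => p.bind fun x => (independentList l).bind fun l =>
          PMF.pure (x, y, l)).map fun z => z.1 :: z.2.1 :: z.2.2 := by
      rw [PMF.bind_comm]
      simp [independentList_cons, PMF.map_bind, PMF.pure_map]
    rw [e1, e2]
    refine CoupledUpTo.of_map _ _ _ ?_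
    simp [List.Perm.swap]
  | trans _ _ ih1 ih2 => simpa using ih1.trans ih2 fun a b c h h' => h.trans h'

theorem coupledUpTo_independentList_append (ps qs : List (PMF α)) :
    CoupledUpTo 0 (fun a b : List α => b.Subperm a) (independentList (ps ++ qs))
      (independentList ps) := by
  have e1 : independentList (ps ++ qs) =
      ((independentList ps).bind fun l => (independentList qs).bind fun l' =>
        PMF.pure (l, l')).map fun z => z.1 ++ z.2 := by
    simp [independentList_append, PMF.map_bind, PMF.pure_map]
  have e2 : independentList ps =
      ((independentList ps).bind fun l => (independentList qs).bind fun l' =>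
        PMF.pure (l, l')).map fun z => z.1 := by
    simp [PMF.map_bind, PMF.pure_map]
  rw [e1]
  conv => arg 4; rw [e2]
  refine CoupledUpTo.of_map _ _ _ ?_
  simp [(List.sublist_append_left _ _).subperm]

theorem coupledUpTo_independentList_subperm {ps qs : List (PMF α)} (h : qs.Subperm ps) :
    CoupledUpTo 0 (fun a b : List α => b.Subperm a) (independentList ps) (independentList qs) := by
  obtain ⟨l, hl, hs⟩ := h
  obtain ⟨rs, hrs⟩ := hs.exists_perm_append
  replace hrs := hrs.trans (hl.append_right rs)
  simpa using (coupledUpTo_independentList_perm hrs).trans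
    (coupledUpTo_independentList_append qs rs) fun a b c h h' => List.Subperm.trans h' h.symm.subperm

theorem CoupledUpTo.bind_independentList {ε : ℝ≥0∞} {μ ν : PMF (List α)}
    (h : CoupledUpTo ε (fun a b => b.Subperm a) μ ν) (p : α → PMF β) :
    CoupledUpTo ε (fun a b => b.Subperm a) (μ.bind fun l => independentList (l.map p))
      (ν.bind fun l => independentList (l.map p)) :=
  h.bind fun _ _ hab => coupledUpTo_independentList_subperm (by
    obtain ⟨l, hl, hs⟩ := hab
    exact ⟨l.map p, hl.map p, hs.map p⟩)

end Coupling

/-! ### Statistical distance and domination from couplings -/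

section Domination

variable {α β : Type*}

theorem statDist_le_of_coupledUpTo {ε : ℝ} (hε : 0 ≤ ε) {μ ν : PMF α}
    (h : CoupledUpTo (ENNReal.ofReal ε) Eq μ ν) : statDist μ ν ≤ ε := by
  classical
  obtain ⟨J, rfl, rfl, h3⟩ := h
  -- Each marginal splits into the common diagonal part `e` and an off-diagonal part, `d₁` or `d₂`.
  -- The parts `e` cancel, and `d₁` and `d₂` each have total mass equal to the probability that the
  -- coordinates differ.
  set d₁ : α → ℝ≥0∞ := fun a => ∑' x : α × α, if x.1 = a ∧ x.1 ≠ x.2 then J x else 0 with hd₁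
  set d₂ : α → ℝ≥0∞ := fun a => ∑' x : α × α, if x.2 = a ∧ x.1 ≠ x.2 then J x else 0 with hd₂
  set e : α → ℝ≥0∞ := fun a => ∑' x : α × α, if x.1 = a ∧ x.2 = a then J x else 0 with he
  have hle : ∀ P : α × α → Prop, ∀ [DecidablePred P], (∑' x, if P x then J x else 0) ≤ 1 := by
    intro P _
    rw [← J.tsum_coe]
    refine ENNReal.tsum_le_tsum fun x => ?_
    split_ifs
    · exact le_rfl
    · exact zero_le
  have hμ : ∀ a, (J.map Prod.fst) a = d₁ a + e a := by
    intro a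
    rw [PMF.map_apply, hd₁, he, ← ENNReal.tsum_add]
    refine tsum_congr fun x => ?_
    by_cases h1 : x.1 = a
    · subst h1
      by_cases h2 : x.1 = x.2
      · simp [h2]
      · simp [h2, Ne.symm h2]
    · simp [h1, Ne.symm h1]
  have hν : ∀ a, (J.map Prod.snd) a = d₂ a + e a := by
    intro a
    rw [PMF.map_apply, hd₂, he, ← ENNReal.tsum_add]
    refine tsum_congr fun x => ?_
    by_cases h1 : x.2 = a
    · subst h1
      by_cases h2 : x.1 = x.2
      · simp [h2]
      · simp [h2]
    · simp [h1, Ne.symm h1]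
  have hbad : ∑' x : α × α, (if x.1 ≠ x.2 then J x else 0) ≤ ENNReal.ofReal ε := by
    rw [PMF.toOuterMeasure_apply] at h3
    refine le_trans (le_of_eq (tsum_congr fun x => ?_)) h3
    by_cases hx : x.1 = x.2 <;> simp [hx]
  have hsum₁ : ∑' a, d₁ a = ∑' x : α × α, (if x.1 ≠ x.2 then J x else 0) := by
    rw [hd₁, ENNReal.tsum_comm]
    refine tsum_congr fun x => ?_
    rw [tsum_eq_single x.1]
    · simp
    · intro a ha; simp [ha.symm]
  have hsum₂ : ∑' a, d₂ a = ∑' x : α × α, (if x.1 ≠ x.2 then J x else 0) := by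
    rw [hd₂, ENNReal.tsum_comm]
    refine tsum_congr fun x => ?_
    rw [tsum_eq_single x.2]
    · simp
    · intro a ha; simp [ha.symm]
  have hpt : ∀ a, ENNReal.ofReal |((J.map Prod.fst) a).toReal - ((J.map Prod.snd) a).toReal| ≤
      d₁ a + d₂ a := by
    intro a
    have t1 : d₁ a ≠ ∞ := ((hle _).trans_lt ENNReal.one_lt_top).ne
    have t2 : d₂ a ≠ ∞ := ((hle _).trans_lt ENNReal.one_lt_top).ne
    have t3 : e a ≠ ∞ := ((hle _).trans_lt ENNReal.one_lt_top).ne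
    rw [hμ, hν, ENNReal.toReal_add t1 t3, ENNReal.toReal_add t2 t3, add_sub_add_right_eq_sub]
    refine ENNReal.ofReal_le_of_le_toReal ?_
    rw [ENNReal.toReal_add t1 t2]
    refine (abs_sub _ _).trans (le_of_eq ?_)
    rw [abs_of_nonneg ENNReal.toReal_nonneg, abs_of_nonneg ENNReal.toReal_nonneg]
  have htot : ∑' a, ENNReal.ofReal
      |((J.map Prod.fst) a).toReal - ((J.map Prod.snd) a).toReal| ≤ ENNReal.ofReal (2 * ε) := by
    refine (ENNReal.tsum_le_tsum hpt).trans ?_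
    rw [ENNReal.tsum_add, hsum₁, hsum₂, two_mul, ENNReal.ofReal_add hε hε]
    exact add_le_add hbad hbad
  have hreal : ∑' a, |((J.map Prod.fst) a).toReal - ((J.map Prod.snd) a).toReal| ≤ 2 * ε := by
    have := ENNReal.toReal_mono ENNReal.ofReal_ne_top htot
    rw [ENNReal.tsum_toReal_eq (fun _ => ENNReal.ofReal_ne_top),
      ENNReal.toReal_ofReal (by positivity)] at this
    simpa [ENNReal.toReal_ofReal] using this
  rw [statDist]
  linarith

theorem dominates_of_coupledUpTo {μ ν : PMF (List α)}
    (h : CoupledUpTo 0 (fun a b => b.Subperm a) μ ν) : Dominates μ ν := by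
  classical
  obtain ⟨J, rfl, rfl, h3⟩ := h
  intro k
  rw [PMF.toOuterMeasure_map_apply, PMF.toOuterMeasure_map_apply]
  refine PMF.toOuterMeasure_mono _ fun x hx a => (hx.1 a).trans (List.Subperm.count_le ?_ a)
  by_contra hcon
  have := (PMF.toOuterMeasure_apply_eq_zero_iff J _).1 (le_antisymm h3 zero_le)
  exact Set.disjoint_left.1 this hx.2 hcon

/-- On the bad event the first coordinate is replaced by the second, which repairs the relation by
reflexivity. The support bound keeps the new law on lists of admissible cosets. -/
theorem CoupledUpTo.exists_left {ε : ℝ≥0∞} {R : α → α → Prop} (hR : ∀ a, R a a) {μ ν : PMF α}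
    (h : CoupledUpTo ε R μ ν) : ∃ μ' : PMF α, CoupledUpTo ε Eq μ μ' ∧ CoupledUpTo 0 R μ' ν ∧
      μ'.support ⊆ μ.support ∪ ν.support := by
  classical
  obtain ⟨J, rfl, rfl, h3⟩ := h
  refine ⟨J.map fun x => if R x.1 x.2 then x.1 else x.2, ?_, ?_, ?_⟩
  · refine CoupledUpTo.of_map J _ _ (le_trans (MeasureTheory.measure_mono ?_) h3)
    intro x hx h
    exact hx (if_pos h).symm
  · refine CoupledUpTo.of_map J _ _ (le_of_eq ?_)
    convert MeasureTheory.measure_empty (μ := J.toOuterMeasure)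
    ext x
    by_cases h : R x.1 x.2 <;> simp [h, hR]
  · intro a ha
    obtain ⟨x, hx, rfl⟩ := (PMF.mem_support_map_iff _ _ _).1 ha
    split_ifs
    · exact Or.inl ((PMF.mem_support_map_iff _ _ _).2 ⟨x, hx, rfl⟩)
    · exact Or.inr ((PMF.mem_support_map_iff _ _ _).2 ⟨x, hx, rfl⟩)

theorem CoupledUpTo.symm {ε : ℝ≥0∞} {R : α → β → Prop} {μ : PMF α} {ν : PMF β}
    (h : CoupledUpTo ε R μ ν) : CoupledUpTo ε (fun b a => R a b) ν μ := by
  obtain ⟨J, rfl, rfl, h3⟩ := h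
  exact CoupledUpTo.of_map J _ _ h3

end Domination

/-! ### Pairing up equal entries -/

section PairedList

variable {α : Type*} [DecidableEq α]

/-- One entry for every pair that the pairing of equal entries of a list forms. -/
def pairedList : List α → List α
  | [] => []
  | x :: l => if x ∈ l then x :: pairedList (l.erase x) else pairedList l
termination_by l => l.length
decreasing_by
  · exact Nat.lt_succ_of_le List.length_erase_le
  · exact Nat.lt_succ_self _

theorem pairedList_nil : pairedList ([] : List α) = [] := by rw [pairedList]

theorem pairedList_cons_of_mem {x : α} {l : List α} (h : x ∈ l) :
    pairedList (x :: l) = x :: pairedList (l.erase x) := by rw [pairedList, if_pos h]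

theorem pairedList_cons_of_notMem {x : α} {l : List α} (h : x ∉ l) :
    pairedList (x :: l) = pairedList l := by rw [pairedList, if_neg h]

/-- Up to order the outcome of the pairing depends only on the multiplicities, and monotonically so.
This makes pairing compatible with `List.Subperm`. -/
theorem count_pairedList (a : α) (l : List α) : (pairedList l).count a = l.count a / 2 := by
  induction hn : l.length using Nat.strong_induction_on generalizing l with
  | _ n ih =>
    cases l with
    | nil => simp [pairedList_nil]
    | cons x l =>
      simp only [List.length_cons] at hn
      by_cases h : x ∈ l
      · have h1 : 0 < l.count x := List.count_pos_iff.2 h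
        rw [pairedList_cons_of_mem h, List.count_cons, List.count_cons,
          ih (l.erase x).length (by have := List.length_erase_of_mem h; omega) _ rfl,
          List.count_erase]
        by_cases hxa : x = a
        · subst hxa; simp; omega
        · simp [hxa]
      · rw [pairedList_cons_of_notMem h, ih l.length (by omega) _ rfl, List.count_cons]
        by_cases hxa : x = a
        · subst hxa; simp [List.count_eq_zero_of_not_mem h]
        · simp [hxa]

theorem List.Subperm.pairedList {l l' : List α} (h : l.Subperm l') :
    (pairedList l).Subperm (_root_.pairedList l') := by
  rw [List.subperm_iff_count] at h ⊢
  intro a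
  rw [count_pairedList, count_pairedList]
  exact Nat.div_le_div_right (h a)

end PairedList

/-! ### Finite products of discrete distributions -/

section PiPMF

open MeasureTheory

variable {ι β γ : Type*} [Fintype ι] [MeasurableSpace β] [Countable β] [MeasurableSingletonClass β]
  [MeasurableSpace γ] [Countable γ] [MeasurableSingletonClass γ]

/-- The law of independent samples from the distributions of a finite family. -/
def piPMF (p : ι → PMF β) : PMF (ι → β) :=
  (Measure.pi fun i => (p i).toMeasure).toPMF

theorem piPMF_apply (p : ι → PMF β) (f : ι → β) : piPMF p f = ∏ i, p i (f i) := by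
  rw [piPMF, Measure.toPMF_apply, Measure.pi_singleton]
  exact Finset.prod_congr rfl fun i _ => PMF.toMeasure_apply_singleton _ _ (measurableSet_singleton _)

theorem toMeasure_piPMF (p : ι → PMF β) :
    (piPMF p).toMeasure = Measure.pi fun i => (p i).toMeasure :=
  Measure.toPMF_toMeasure _

theorem map_piPMF (p : ι → PMF β) (g : β → γ) :
    (piPMF p).map (fun f i => g (f i)) = piPMF fun i => (p i).map g := by
  apply PMF.toMeasure_injective
  rw [← PMF.toMeasure_map _ _ (measurable_of_countable _), toMeasure_piPMF, toMeasure_piPMF]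
  have (i : ι) : ((p i).map g).toMeasure = (p i).toMeasure.map g :=
    (PMF.toMeasure_map _ _ (measurable_of_countable _)).symm
  simp_rw [this]
  have (i : ι) : IsProbabilityMeasure ((p i).toMeasure.map g) :=
    Measure.isProbabilityMeasure_map (measurable_of_countable _).aemeasurable
  exact Measure.pi_map_pi fun i => (measurable_of_countable _).aemeasurable

theorem map_eval_piPMF (p : ι → PMF β) (i : ι) : (piPMF p).map (fun f => f i) = p i := by
  apply PMF.toMeasure_injective
  rw [← PMF.toMeasure_map _ _ (measurable_of_countable _), toMeasure_piPMF]
  exact (measurePreserving_eval (fun i => (p i).toMeasure) i).map_eq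

/-- The coordinates are coupled independently of each other, and the bad events obey the union
bound. -/
theorem CoupledUpTo.piPMF {ε : ι → ℝ≥0∞} {R : β → γ → Prop} {p : ι → PMF β} {q : ι → PMF γ}
    (h : ∀ i, CoupledUpTo (ε i) R (p i) (q i)) :
    CoupledUpTo (∑ i, ε i) (fun f g => ∀ i, R (f i) (g i)) (piPMF p) (_root_.piPMF q) := by
  choose J h1 h2 h3 using h
  have e1 := map_piPMF J Prod.fst
  have e2 := map_piPMF J Prod.snd
  simp only [h1, h2] at e1 e2
  rw [← e1, ← e2]
  refine CoupledUpTo.of_map _ _ _ ?_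
  calc (_root_.piPMF J).toOuterMeasure {x | ¬ ∀ i, R (x i).1 (x i).2}
      ≤ (_root_.piPMF J).toOuterMeasure (⋃ i, {x | ¬ R (x i).1 (x i).2}) := by
        refine measure_mono fun x hx => ?_
        simpa using hx
    _ ≤ ∑ i, (_root_.piPMF J).toOuterMeasure {x | ¬ R (x i).1 (x i).2} :=
        measure_iUnion_fintype_le _ _
    _ ≤ ∑ i, ε i := by
        refine Finset.sum_le_sum fun i _ => (le_of_eq ?_).trans (h3 i)
        rw [← map_eval_piPMF J i, PMF.toOuterMeasure_map_apply]
        rfl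

end PiPMF

/-! ### The Poisson distribution -/

section Poisson

open MeasureTheory ProbabilityTheory
open scoped NNReal

/-- The Poisson distribution. -/
def poisson (r : ℝ≥0) : PMF ℕ := (poissonMeasure r).toPMF

theorem poisson_apply (r : ℝ≥0) (n : ℕ) :
    poisson r n = ENNReal.ofReal (Real.exp (-r) * r ^ n / n.factorial) := by
  rw [poisson, Measure.toPMF_apply, poissonMeasure_singleton]

theorem toMeasure_poisson (r : ℝ≥0) : (poisson r).toMeasure = poissonMeasure r :=
  Measure.toPMF_toMeasure _

theorem poisson_toOuterMeasure (r : ℝ≥0) (S : Set ℕ) :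
    (poisson r).toOuterMeasure S = poissonMeasure r S := by
  rw [← PMF.toMeasure_apply_eq_toOuterMeasure, toMeasure_poisson]

/-- Markov's inequality for w z^N, whose mean is w exp(r (z - 1)). The mean is read off from the
total mass of the tilted law with parameter r z. -/
theorem poisson_chernoff (r : ℝ≥0) {S : Set ℕ} {w z : ℝ} (hw : 0 ≤ w) (hz : 0 ≤ z)
    (h : ∀ n ∈ S, 1 ≤ w * z ^ n) :
    (poisson r).toOuterMeasure S ≤ ENNReal.ofReal (w * Real.exp (r * (z - 1))) := by
  lift z to ℝ≥0 using hz
  have hs := (hasSum_one_poissonMeasure (r * z)).mul_left (w * Real.exp (r * (z - 1)))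
  rw [mul_one] at hs
  rw [PMF.toOuterMeasure_apply, ← hs.tsum_eq,
    ENNReal.ofReal_tsum_of_nonneg (fun n => by positivity) hs.summable]
  refine ENNReal.tsum_le_tsum fun n => ?_
  by_cases hn : n ∈ S
  · rw [Set.indicator_of_mem hn, poisson_apply]
    refine ENNReal.ofReal_le_ofReal ?_
    have e : w * Real.exp (r * (z - 1)) * (Real.exp (-((r * z : ℝ≥0) : ℝ)) *
        ((r * z : ℝ≥0) : ℝ) ^ n / n.factorial) =
        (w * z ^ n) * (Real.exp (-r) * r ^ n / n.factorial) := by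
      have : Real.exp (r * (z - 1)) * Real.exp (-(r * z)) = Real.exp (-r) := by
        rw [← Real.exp_add]; ring_nf
      push_cast
      rw [← this, mul_pow]
      ring
    rw [e]
    exact le_mul_of_one_le_left (by positivity) (h n hn)
  · rw [Set.indicator_of_notMem hn]
    exact zero_le

/-- Since (k + n)! ≥ k! n!, the weight at k + n is at most r^k / k! times the weight at n. -/
theorem poisson_tail_le (r : ℝ≥0) (k : ℕ) :
    (poisson r).toOuterMeasure (Set.Ici k) ≤ ENNReal.ofReal (r ^ k / k.factorial) := by
  have hs := (hasSum_one_poissonMeasure r).mul_left ((r : ℝ) ^ k / k.factorial)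
  rw [mul_one] at hs
  rw [PMF.toOuterMeasure_apply, ← hs.tsum_eq,
    ENNReal.ofReal_tsum_of_nonneg (fun n => by positivity) hs.summable,
    ← (add_right_injective k).tsum_eq (f := (Set.Ici k).indicator (poisson r))]
  · refine ENNReal.tsum_le_tsum fun n => ?_
    rw [Set.indicator_of_mem (by simp), poisson_apply]
    refine ENNReal.ofReal_le_ofReal ?_
    have h1 : ((k.factorial * n.factorial : ℕ) : ℝ) ≤ (k + n).factorial := by
      exact_mod_cast Nat.le_of_dvd (Nat.factorial_pos _)
        (Nat.factorial_mul_factorial_dvd_factorial_add k n)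
    push_cast at h1
    calc Real.exp (-r) * r ^ (k + n) / (k + n).factorial
        ≤ Real.exp (-r) * r ^ (k + n) / (k.factorial * n.factorial) := by gcongr
      _ = _ := by rw [pow_add]; field_simp
  · intro n hn
    have : n ∈ Set.Ici k := by
      by_contra h
      simp [h] at hn
    exact ⟨n - k, by simp at this; simp; omega⟩

theorem poisson_tail_mono {x r : ℝ≥0} (h : x ≤ r) (j : ℕ) :
    (poisson x).toOuterMeasure (Set.Ici j) ≤ (poisson r).toOuterMeasure (Set.Ici j) := by
  rw [poisson_toOuterMeasure, poisson_toOuterMeasure]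
  -- A Poisson variable with the larger parameter is the sum of one with parameter `x` and an
  -- independent one.
  obtain ⟨y, rfl⟩ := exists_add_of_le h
  rw [← poissonMeasure_conv_poissonMeasure, Measure.conv,
    Measure.map_apply (measurable_of_countable _) measurableSet_Ici]
  calc poissonMeasure x (Set.Ici j)
      = ((poissonMeasure x).prod (poissonMeasure y)) (Set.Ici j ×ˢ Set.univ) := by
        rw [Measure.prod_prod, measure_univ, mul_one]
    _ ≤ _ := measure_mono fun z hz => by
        simp at hz ⊢; omega

theorem le_poisson_tail {x r : ℝ≥0} (h : x ≤ r) (j : ℕ) :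
    ENNReal.ofReal (Real.exp (-x) * x ^ j / j.factorial) ≤
      (poisson r).toOuterMeasure (Set.Ici j) := by
  refine le_trans ?_ (poisson_tail_mono h j)
  rw [← poisson_apply, ← PMF.toOuterMeasure_apply_singleton]
  exact measure_mono (by simp)

end Poisson

/-! ### Quantile couplings -/

section Quantile

open MeasureTheory

/-- The probability that a sample is at least `k`. -/
def upperTail (p : PMF ℕ) (k : ℕ) : ℝ := (p.toOuterMeasure (Set.Ici k)).toReal

theorem toOuterMeasure_ne_top {α : Type*} (p : PMF α) (S : Set α) : p.toOuterMeasure S ≠ ∞ := by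
  refine ((measure_mono (Set.subset_univ S)).trans_lt ?_).ne
  rw [(p.toOuterMeasure_apply_eq_one_iff _).2 (Set.subset_univ _)]
  exact ENNReal.one_lt_top

theorem upperTail_antitone (p : PMF ℕ) : Antitone (upperTail p) := fun _ _ h =>
  ENNReal.toReal_mono (toOuterMeasure_ne_top p _) (measure_mono (Set.Ici_subset_Ici.2 h))

theorem upperTail_zero (p : PMF ℕ) : upperTail p 0 = 1 := by
  rw [upperTail, (p.toOuterMeasure_apply_eq_one_iff _).2 (by intro x; simp)]
  rfl

theorem tendsto_upperTail (p : PMF ℕ) :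
    Filter.Tendsto (upperTail p) Filter.atTop (nhds 0) := by
  have h := tendsto_measure_iInter_atTop (μ := p.toMeasure) (s := fun k : ℕ => Set.Ici k)
    (fun _ => measurableSet_Ici.nullMeasurableSet) (fun _ _ h => Set.Ici_subset_Ici.2 h)
    ⟨0, measure_ne_top _ _⟩
  have he : ⋂ k : ℕ, Set.Ici k = ∅ := by
    ext x
    simp only [Set.mem_iInter, Set.mem_Ici, Set.mem_empty_iff_false, iff_false, not_forall]
    exact ⟨x + 1, by omega⟩
  rw [he, measure_empty] at h
  have h' := (ENNReal.tendsto_toReal ENNReal.zero_ne_top).comp h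
  refine h'.congr fun k => ?_
  simp [upperTail, PMF.toMeasure_apply_eq_toOuterMeasure]

/-- The quantile function of a distribution on `ℕ`. -/
def upperQuantile (p : PMF ℕ) (u : ℝ) : ℕ := sInf {k | upperTail p (k + 1) < u}

/-- The condition 0 < u is needed: for u ≤ 0 the set that defines the quantile is empty and its
`sInf` is 0. -/
theorem succ_le_upperQuantile_iff (p : PMF ℕ) (u : ℝ) (j : ℕ) :
    j + 1 ≤ upperQuantile p u ↔ u ∈ Set.Ioc 0 (upperTail p (j + 1)) := by
  constructor
  · intro h
    have hne : {k | upperTail p (k + 1) < u}.Nonempty := by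
      by_contra hne
      rw [Set.not_nonempty_iff_eq_empty] at hne
      simp [upperQuantile, hne] at h
    refine ⟨?_, ?_⟩
    · obtain ⟨k, hk⟩ := hne
      exact lt_of_le_of_lt ENNReal.toReal_nonneg hk
    · by_contra hcon
      have : upperQuantile p u ≤ j := Nat.sInf_le (by simpa using hcon)
      omega
  · rintro ⟨h0, h1⟩
    have hne : {k | upperTail p (k + 1) < u}.Nonempty := by
      have := ((tendsto_upperTail p).comp (Filter.tendsto_add_atTop_nat 1)).eventually
        (gt_mem_nhds h0)
      exact this.exists
    by_contra hcon
    have hmem := Nat.sInf_mem hne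
    change upperTail p (upperQuantile p u + 1) < u at hmem
    have := upperTail_antitone p (show upperQuantile p u + 1 ≤ j + 1 by omega)
    linarith

theorem measurable_upperQuantile (p : PMF ℕ) : Measurable (upperQuantile p) := by
  refine measurable_of_Ici fun j => ?_
  cases j with
  | zero =>
    have : upperQuantile p ⁻¹' Set.Ici 0 = Set.univ := by ext; simp
    rw [this]; exact MeasurableSet.univ
  | succ j =>
    have : upperQuantile p ⁻¹' Set.Ici (j + 1) = Set.Ioc 0 (upperTail p (j + 1)) := by
      ext u; exact succ_le_upperQuantile_iff p u j
    rw [this]; exact measurableSet_Ioc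

theorem map_upperQuantile (p : PMF ℕ) :
    (volume.restrict (Set.Ioc (0 : ℝ) 1)).map (upperQuantile p) = p.toMeasure := by
  have : IsProbabilityMeasure (volume.restrict (Set.Ioc (0 : ℝ) 1)) := ⟨by simp⟩
  have := Measure.isProbabilityMeasure_map (μ := volume.restrict (Set.Ioc (0 : ℝ) 1))
    (measurable_upperQuantile p).aemeasurable
  refine Measure.ext_of_Ici _ _ fun j => ?_
  rw [Measure.map_apply (measurable_upperQuantile p) measurableSet_Ici]
  cases j with
  | zero =>
    have h1 : upperQuantile p ⁻¹' Set.Ici 0 = Set.univ := by ext; simp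
    have h2 : Set.Ici (0 : ℕ) = Set.univ := by ext; simp
    rw [h1, h2, measure_univ, measure_univ]
  | succ j =>
    have h1 : upperQuantile p ⁻¹' Set.Ici (j + 1) = Set.Ioc 0 (upperTail p (j + 1)) := by
      ext u; exact succ_le_upperQuantile_iff p u j
    have h2 : upperTail p (j + 1) ≤ 1 := by
      rw [← upperTail_zero p]; exact upperTail_antitone p (Nat.zero_le _)
    rw [h1, Measure.restrict_apply measurableSet_Ioc,
      Set.inter_eq_left.2 (Set.Ioc_subset_Ioc_right h2), Real.volume_Ioc, sub_zero, upperTail,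
      ENNReal.ofReal_toReal (toOuterMeasure_ne_top p _), PMF.toMeasure_apply_eq_toOuterMeasure]

/-- Comparing tails up to a cutoff suffices for an approximate coupling. -/
theorem coupledUpTo_two_mul_le_of_tails {a b : PMF ℕ} (k₀ : ℕ)
    (h : ∀ k, 1 ≤ k → k ≤ k₀ →
      b.toOuterMeasure (Set.Ici k) ≤ a.toOuterMeasure (Set.Ici (2 * k))) :
    CoupledUpTo (b.toOuterMeasure (Set.Ici (k₀ + 1))) (fun x y => 2 * y ≤ x) a b := by
  have hprob : IsProbabilityMeasure (volume.restrict (Set.Ioc (0 : ℝ) 1)) := ⟨by simp⟩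
  have hm : Measurable fun u => (upperQuantile a u, upperQuantile b u) :=
    (measurable_upperQuantile a).prodMk (measurable_upperQuantile b)
  have := Measure.isProbabilityMeasure_map (μ := volume.restrict (Set.Ioc (0 : ℝ) 1))
    hm.aemeasurable
  -- The monotone coupling: both quantile functions are evaluated at the same uniform variable.
  refine ⟨((volume.restrict (Set.Ioc (0 : ℝ) 1)).map
    fun u => (upperQuantile a u, upperQuantile b u)).toPMF, ?_, ?_, ?_⟩
  · apply PMF.toMeasure_injective
    rw [← PMF.toMeasure_map _ _ (measurable_of_countable _), Measure.toPMF_toMeasure,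
      Measure.map_map (measurable_of_countable _) hm]
    exact map_upperQuantile a
  · apply PMF.toMeasure_injective
    rw [← PMF.toMeasure_map _ _ (measurable_of_countable _), Measure.toPMF_toMeasure,
      Measure.map_map (measurable_of_countable _) hm]
    exact map_upperQuantile b
  · rw [← PMF.toMeasure_apply_eq_toOuterMeasure, Measure.toPMF_toMeasure,
      ← PMF.toMeasure_apply_eq_toOuterMeasure, ← map_upperQuantile b,
      Measure.map_apply hm (Set.to_countable _).measurableSet,
      Measure.map_apply (measurable_upperQuantile b) measurableSet_Ici]
    refine measure_mono fun u hu => ?_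
    by_contra hcon
    simp only [Set.mem_preimage, Set.mem_Ici, not_le] at hcon
    apply hu
    change 2 * upperQuantile b u ≤ upperQuantile a u
    rcases Nat.eq_zero_or_pos (upperQuantile b u) with h0 | h0
    · omega
    · obtain ⟨j, hj⟩ : ∃ j, upperQuantile b u = j + 1 := ⟨_, (Nat.succ_pred_eq_of_pos h0).symm⟩
      have h1 := (succ_le_upperQuantile_iff b u j).1 hj.ge
      -- If the second quantile is j + 1 ≤ k₀, then u lies below the tail of `b` at j + 1, hence
      -- below that of `a` at 2(j + 1).
      have h2 := ENNReal.toReal_mono (toOuterMeasure_ne_top a _) (h (j + 1) (by omega) (by omega))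
      have := (succ_le_upperQuantile_iff a u (2 * j + 1)).2 ⟨h1.1, h1.2.trans h2⟩
      omega

end Quantile

/-! ### Poissonization -/

section Poissonization

open scoped NNReal

variable {α : Type*} [DecidableEq α]

/-- The multiplicities of the entries of a list. -/
def countVec (l : List α) : α → ℕ := fun a => l.count a

theorem countVec_cons (a : α) (l : List α) : countVec (a :: l) = countVec l + Pi.single a 1 := by
  ext b
  by_cases h : a = b
  · subst h; simp [countVec]
  · simp [countVec, h, Ne.symm h]

theorem countVec_cons_map_apply (μ : PMF (List α)) (a : α) (n : α → ℕ) :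
    (μ.map fun l => countVec (a :: l)) n =
      if n a = 0 then 0 else (μ.map countVec) (n - Pi.single a 1) := by
  simp only [PMF.map_apply, countVec_cons]
  split_ifs with h
  · refine ENNReal.tsum_eq_zero.2 fun l => if_neg ?_
    rintro rfl
    simp at h
  · refine tsum_congr fun l => ?_
    congr 1
    rw [eq_iff_iff]
    constructor
    · rintro rfl; simp
    · intro h'
      rw [← h']
      ext b
      by_cases hb : b = a
      · subst hb; simp; omega
      · simp [hb]

variable [Fintype α]

/-- The multinomial law, with the factorials multiplied out to avoid division in `ℝ≥0∞`. The
induction conditions on the first sample a, which lowers n a by one. -/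
theorem iidList_map_countVec (q : PMF α) (K : ℕ) (n : α → ℕ) :
    ((iidList K q).map countVec) n * ((∏ a, (n a).factorial : ℕ) : ℝ≥0∞) =
      if ∑ a, n a = K then (K.factorial : ℝ≥0∞) * ∏ a, q a ^ n a else 0 := by
  induction K generalizing n with
  | zero =>
    rw [iidList_zero, PMF.pure_map, PMF.pure_apply]
    by_cases h : n = 0
    · subst h
      have : countVec ([] : List α) = 0 := rfl
      simp [this]
    · have h' : n ≠ countVec [] := h
      have h2 : ∑ a, n a ≠ 0 := by
        intro h2
        apply h
        ext a
        exact Finset.sum_eq_zero_iff.1 h2 a (Finset.mem_univ a)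
      rw [if_neg h', if_neg h2, zero_mul]
  | succ K ih =>
    have hrec : ((iidList (K + 1) q).map countVec) n =
        ∑ a, q a * (if n a = 0 then 0 else
          ((iidList K q).map countVec) (n - Pi.single a 1)) := by
      rw [iidList_succ, PMF.map_bind, PMF.bind_apply, tsum_fintype]
      refine Finset.sum_congr rfl fun a _ => ?_
      rw [← countVec_cons_map_apply, PMF.map_bind]
      simp only [PMF.pure_map]
      rfl
    have hterm : ∀ a, q a * (if n a = 0 then 0 else
          ((iidList K q).map countVec) (n - Pi.single a 1)) *
            ((∏ a, (n a).factorial : ℕ) : ℝ≥0∞) =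
        if ∑ a, n a = K + 1 then (n a : ℝ≥0∞) * ((K.factorial : ℝ≥0∞) * ∏ a, q a ^ n a)
          else 0 := by
      intro a
      by_cases ha : n a = 0
      · simp [ha]
      · obtain ⟨m, rfl⟩ : ∃ m : α → ℕ, n = m + Pi.single a 1 := by
          refine ⟨n - Pi.single a 1, ?_⟩
          ext b
          by_cases hb : b = a
          · subst hb; simp; omega
          · simp [hb]
        have h1 : m + Pi.single a 1 - Pi.single a 1 = m := by ext; simp
        have h2 : ∑ b, (m + Pi.single a 1 : α → ℕ) b = ∑ b, m b + 1 := by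
          simp [Finset.sum_add_distrib]
        have h3 : ∏ b, ((m + Pi.single a 1 : α → ℕ) b).factorial =
            (m a + 1) * ∏ b, (m b).factorial := by
          rw [← Finset.mul_prod_erase _ _ (Finset.mem_univ a),
            ← Finset.mul_prod_erase _ (fun b => (m b).factorial) (Finset.mem_univ a), ← mul_assoc]
          congr 1
          · simp [Nat.factorial_succ]
          · refine Finset.prod_congr rfl fun b hb => ?_
            simp [Finset.ne_of_mem_erase hb]
        have h4 : ∏ b, q b ^ (m + Pi.single a 1 : α → ℕ) b = q a * ∏ b, q b ^ m b := by
          rw [← Finset.mul_prod_erase _ _ (Finset.mem_univ a),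
            ← Finset.mul_prod_erase _ (fun b => q b ^ m b) (Finset.mem_univ a), ← mul_assoc]
          congr 1
          · simp [pow_succ, mul_comm]
          · refine Finset.prod_congr rfl fun b hb => ?_
            simp [Finset.ne_of_mem_erase hb]
        rw [if_neg ha, h1, h2, h3, h4]
        have ih' := ih m
        by_cases hm : ∑ b, m b = K
        · rw [if_pos hm] at ih'
          rw [if_pos (by omega)]
          push_cast at ih' ⊢
          calc _ = (((m a : ℝ≥0∞) + 1) * q a) * (((iidList K q).map countVec) m *
                ∏ b, ((m b).factorial : ℝ≥0∞)) := by ring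
            _ = _ := by rw [ih']; simp; ring
        · rw [if_neg hm] at ih'
          rw [if_neg (by omega)]
          push_cast at ih' ⊢
          calc _ = (((m a : ℝ≥0∞) + 1) * q a) * (((iidList K q).map countVec) m *
                ∏ b, ((m b).factorial : ℝ≥0∞)) := by ring
            _ = _ := by rw [ih', mul_zero]
    rw [hrec, Finset.sum_mul, Finset.sum_congr rfl fun a _ => hterm a]
    split_ifs with h
    -- The factors n a sum to K + 1, which turns K! into (K + 1)!.
    · rw [← Finset.sum_mul, ← Nat.cast_sum, h, Nat.factorial_succ]
      push_cast
      ring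
    · simp

/-- A list of independent samples of Poisson length. -/
def poissonList {α : Type*} (r : ℝ≥0) (q : PMF α) : PMF (List α) :=
  (poisson r).bind fun K => iidList K q

/-- Only the length ∑ n a contributes to the multiplicities n. Its factorial cancels against the
multinomial one, and the rest factors because the probabilities q a sum to 1. -/
theorem poissonList_map_countVec (r : ℝ≥0) (q : PMF α) :
    (poissonList r q).map countVec = piPMF fun a => poisson (r * (q a).toNNReal) := by
  ext n
  have hq : ∑ a, (q a).toReal = 1 := by
    have := q.tsum_coe
    rw [tsum_fintype] at this
    have h2 := congrArg ENNReal.toReal this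
    rw [ENNReal.toReal_sum (fun a _ => q.apply_ne_top a)] at h2
    simpa using h2
  set N := ∑ a, n a with hN
  have hF : ((∏ a, (n a).factorial : ℕ) : ℝ≥0∞) ≠ 0 := by
    rw [Nat.cast_ne_zero]
    exact Finset.prod_ne_zero_iff.2 fun a _ => Nat.factorial_ne_zero _
  have hF' : ((∏ a, (n a).factorial : ℕ) : ℝ≥0∞) ≠ ∞ := ENNReal.natCast_ne_top _
  rw [← ENNReal.mul_left_inj hF hF', poissonList, PMF.map_bind, PMF.bind_apply,
    ← ENNReal.tsum_mul_right, tsum_eq_single N]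
  · rw [mul_assoc, iidList_map_countVec, if_pos hN.symm, piPMF_apply, poisson_apply]
    simp only [poisson_apply]
    have hqa : ∀ a, q a = ENNReal.ofReal (q a).toReal := fun a =>
      (ENNReal.ofReal_toReal (q.apply_ne_top a)).symm
    have hcast : ∀ k : ℕ, (k : ℝ≥0∞) = ENNReal.ofReal (k : ℝ) := fun k =>
      (ENNReal.ofReal_natCast k).symm
    have hprod : ∏ a, q a ^ n a = ENNReal.ofReal (∏ a, (q a).toReal ^ n a) := by
      rw [ENNReal.ofReal_prod_of_nonneg (fun a _ => by positivity)]
      refine Finset.prod_congr rfl fun a _ => ?_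
      rw [ENNReal.ofReal_pow (by positivity), ← hqa]
    rw [hprod, hcast, hcast, ← ENNReal.ofReal_prod_of_nonneg (fun a _ => by positivity),
      ← ENNReal.ofReal_mul (by positivity), ← ENNReal.ofReal_mul (by positivity),
      ← ENNReal.ofReal_mul (Finset.prod_nonneg fun a _ => by positivity)]
    congr 1
    have hexp : Real.exp (-(r : ℝ)) = ∏ a, Real.exp (-((r * (q a).toNNReal : ℝ≥0) : ℝ)) := by
      rw [← Real.exp_sum]
      congr 1
      push_cast
      rw [Finset.sum_neg_distrib, ← Finset.mul_sum, hq, mul_one]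
    have hpow : (r : ℝ) ^ N = ∏ a, (r : ℝ) ^ n a := (Finset.prod_pow_eq_pow_sum _ _ _).symm
    push_cast
    rw [← Finset.prod_mul_distrib]
    calc _ = Real.exp (-(r : ℝ)) * (r : ℝ) ^ N * ∏ a, (q a).toReal ^ n a := by
          have : (N.factorial : ℝ) ≠ 0 := Nat.cast_ne_zero.2 (Nat.factorial_ne_zero _)
          field_simp
      _ = _ := by
          rw [hexp, hpow, ← Finset.prod_mul_distrib, ← Finset.prod_mul_distrib]
          refine Finset.prod_congr rfl fun a _ => ?_
          have : ((n a).factorial : ℝ) ≠ 0 := Nat.cast_ne_zero.2 (Nat.factorial_ne_zero _)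
          push_cast
          field_simp
          ring
  · intro K hK
    rw [mul_assoc, iidList_map_countVec, if_neg hK.symm, mul_zero]

/-! ### Comparison of fixed and Poisson lengths -/

theorem coupledUpTo_iidList_of_le {α : Type*} (q : PMF α) {K M : ℕ} (h : K ≤ M) :
    CoupledUpTo 0 (fun a b => b.Subperm a) (iidList M q) (iidList K q) := by
  obtain ⟨N, rfl⟩ := Nat.exists_eq_add_of_le h
  rw [iidList, iidList, List.replicate_add]
  exact coupledUpTo_independentList_append _ _

theorem coupledUpTo_iidList_bind {α : Type*} (q : PMF α) (μ ν : PMF ℕ) {ε : ℝ≥0∞}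
    (h : CoupledUpTo ε (fun x y => y ≤ x) μ ν) :
    CoupledUpTo ε (fun a b => b.Subperm a) (μ.bind fun K => iidList K q)
      (ν.bind fun K => iidList K q) :=
  h.bind fun _ _ hab => coupledUpTo_iidList_of_le q hab

theorem coupledUpTo_iidList_poissonList {α : Type*} (q : PMF α) (M : ℕ) (r : ℝ≥0) :
    CoupledUpTo ((poisson r).toOuterMeasure {K | ¬ K ≤ M}) (fun a b => b.Subperm a)
      (iidList M q) (poissonList r q) := by
  have h := coupledUpTo_iidList_bind q (PMF.pure M) (poisson r)
    (ε := (poisson r).toOuterMeasure {K | ¬ K ≤ M}) (by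
      have := CoupledUpTo.of_map (R := fun x y : ℕ => y ≤ x) (poisson r) (fun _ => M) id
        (le_refl _)
      have e := PMF.map_const (poisson r) M
      change (poisson r).map (fun _ => M) = _ at e
      rwa [e, PMF.map_id] at this)
  rwa [PMF.pure_bind] at h

theorem coupledUpTo_poissonList_iidList {α : Type*} (q : PMF α) (M : ℕ) (r : ℝ≥0) :
    CoupledUpTo ((poisson r).toOuterMeasure {K | ¬ M ≤ K}) (fun a b => b.Subperm a)
      (poissonList r q) (iidList M q) := by
  have h := coupledUpTo_iidList_bind q (poisson r) (PMF.pure M)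
    (ε := (poisson r).toOuterMeasure {K | ¬ M ≤ K}) (by
      have := CoupledUpTo.of_map (R := fun x y : ℕ => y ≤ x) (poisson r) id (fun _ => M)
        (le_refl _)
      have e := PMF.map_const (poisson r) M
      change (poisson r).map (fun _ => M) = _ at e
      rwa [e, PMF.map_id] at this)
  rwa [PMF.pure_bind] at h

end Poissonization

/-! ### Poisson variables and halves of Poisson variables -/

section HalfPoisson

open scoped NNReal

theorem factorial_two_mul_le (k : ℕ) : (2 * k).factorial ≤ k.factorial * (2 * k) ^ k := by
  have h1 := Nat.factorial_mul_ascFactorial k k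
  have h2 := Nat.ascFactorial_le_pow_add k k
  rw [← two_mul] at h1 h2
  rw [← h1]
  exact Nat.mul_le_mul_left _ h2

/-- The bound (2k)! ≤ k! (2k)^k costs a factor (2k)^k, and exp(-x) ≥ 1/3 costs at most 3^k. Both are
paid for by 200κ ≥ 6k. -/
theorem pow_div_factorial_le_poisson_weight {x μ κ : ℝ} (hx : 0 ≤ x) (hx1 : x ≤ 1) (hμ : 0 ≤ μ)
    (hκ : 0 < κ) (h : μ ≤ x ^ 2 / (200 * κ)) {k : ℕ} (hk : 1 ≤ k) (hkκ : (k : ℝ) ≤ κ) :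
    μ ^ k / k.factorial ≤ Real.exp (-x) * x ^ (2 * k) / (2 * k).factorial := by
  have hk0 : (0 : ℝ) < k := by exact_mod_cast hk
  have hfac : ((2 * k).factorial : ℝ) ≤ k.factorial * (2 * k) ^ k := by
    exact_mod_cast factorial_two_mul_le k
  have hexp : (1 / 3 : ℝ) ^ k ≤ Real.exp (-x) := by
    calc (1 / 3 : ℝ) ^ k ≤ (1 / 3 : ℝ) ^ 1 := pow_le_pow_of_le_one (by norm_num) (by norm_num) hk
      _ ≤ Real.exp (-1) := by
          rw [Real.exp_neg, pow_one, one_div]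
          exact inv_anti₀ (Real.exp_pos _) (Real.exp_one_lt_d9.le.trans (by norm_num))
      _ ≤ Real.exp (-x) := Real.exp_le_exp.2 (by linarith)
  have hkf : (0 : ℝ) < k.factorial := by exact_mod_cast Nat.factorial_pos k
  have h2kf : (0 : ℝ) < (2 * k).factorial := by exact_mod_cast Nat.factorial_pos (2 * k)
  calc μ ^ k / k.factorial ≤ (x ^ 2 / (200 * κ)) ^ k / k.factorial := by gcongr
    _ ≤ (x ^ 2 / (6 * k)) ^ k / k.factorial := by
        gcongr
        linarith
    _ = (1 / 3 : ℝ) ^ k * x ^ (2 * k) / (k.factorial * (2 * k) ^ k) := by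
        have h6 : (6 * k : ℝ) ^ k = 3 ^ k * (2 * k) ^ k := by rw [← mul_pow]; ring_nf
        rw [pow_mul, div_pow, h6, one_div, inv_pow]
        field_simp
    _ ≤ Real.exp (-x) * x ^ (2 * k) / (2 * k).factorial := by gcongr

/-- For 1 ≤ k ≤ κ the tail at k of the small variable is below a single weight at 2k of a Poisson
variable of parameter at most l. Values beyond κ count as errors; one factor μ is kept in the error
so that it can be summed over the cosets. -/
theorem coupledUpTo_poisson_of_light {l μ : ℝ≥0} {κ : ℝ} (hκ : 1 ≤ κ) (hl : (l : ℝ) ≤ κ)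
    (h1 : (μ : ℝ) ≤ l ^ 2 / (200 * κ ^ 3)) (h2 : (μ : ℝ) ≤ 1 / 4) :
    CoupledUpTo (ENNReal.ofReal (4 * μ * Real.exp (-κ))) (fun x y => 2 * y ≤ x)
      (poisson l) (poisson μ) := by
  -- Capping the parameter at 1 keeps exp(-x) bounded below. As l ≤ κ it loses at most a factor κ,
  -- which is why the hypothesis on μ has κ³ instead of κ.
  set x : ℝ≥0 := min l 1 with hx
  have hxl : (l : ℝ) ≤ x * κ := by
    rw [hx]
    rcases le_total l 1 with h | h
    · rw [min_eq_left h]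
      exact le_mul_of_one_le_right l.2 hκ
    · rw [min_eq_right h]
      simpa using hl
  have hμx : (μ : ℝ) ≤ x ^ 2 / (200 * κ) := by
    refine h1.trans ?_
    calc (l : ℝ) ^ 2 / (200 * κ ^ 3) ≤ (x * κ) ^ 2 / (200 * κ ^ 3) := by gcongr
      _ = x ^ 2 / (200 * κ) := by field_simp
  refine (coupledUpTo_two_mul_le_of_tails ⌊κ⌋₊ fun k hk hk' => ?_).mono ?_ fun _ _ h => h
  · refine (poisson_tail_le μ k).trans ((ENNReal.ofReal_le_ofReal ?_).trans
      (le_poisson_tail (min_le_left l 1) (2 * k)))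
    exact pow_div_factorial_le_poisson_weight x.2 (by exact_mod_cast min_le_right l 1) μ.2
      (by linarith) hμx hk ((Nat.le_floor_iff (by linarith)).1 hk')
  · refine (poisson_tail_le μ _).trans (ENNReal.ofReal_le_ofReal ?_)
    have hf : (1 : ℝ) ≤ (⌊κ⌋₊ + 1).factorial := by exact_mod_cast Nat.factorial_pos _
    have he : (1 / 4 : ℝ) ≤ Real.exp (-1) := by
      rw [Real.exp_neg, one_div]
      exact inv_anti₀ (Real.exp_pos _) (Real.exp_one_lt_d9.le.trans (by norm_num))
    calc (μ : ℝ) ^ (⌊κ⌋₊ + 1) / (⌊κ⌋₊ + 1).factorial ≤ (μ : ℝ) ^ (⌊κ⌋₊ + 1) :=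
          div_le_self (by positivity) hf
      _ = (μ : ℝ) ^ ⌊κ⌋₊ * μ := pow_succ _ _
      _ ≤ (1 / 4) ^ ⌊κ⌋₊ * μ := by gcongr
      _ = 4 * μ * (1 / 4) ^ (⌊κ⌋₊ + 1) := by ring
      _ ≤ 4 * μ * Real.exp (-1) ^ (⌊κ⌋₊ + 1) := by gcongr
      _ ≤ 4 * μ * Real.exp (-κ) := by
          gcongr
          rw [← Real.exp_nat_mul]
          refine Real.exp_le_exp.2 ?_
          have := (Nat.lt_floor_add_one κ).le
          push_cast
          linarith

theorem poisson_lower_tail (r : ℝ≥0) (a : ℝ) :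
    (poisson r).toOuterMeasure {n | (n : ℝ) < a} ≤
      ENNReal.ofReal (Real.exp (a * Real.log 2 - r / 2)) := by
  have h2 : ∀ n : ℕ, (1 / 2 : ℝ) ^ n = Real.exp (-(n * Real.log 2)) := fun n => by
    rw [Real.exp_neg, Real.exp_nat_mul, Real.exp_log (by norm_num), one_div, inv_pow]
  refine (poisson_chernoff r (w := Real.exp (a * Real.log 2)) (z := 1 / 2) (Real.exp_pos _).le
    (by norm_num) fun n hn => ?_).trans (le_of_eq ?_)
  · rw [h2, ← Real.exp_add]
    refine Real.one_le_exp ?_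
    have : (n : ℝ) < a := hn
    nlinarith [Real.log_pos one_lt_two]
  · rw [← Real.exp_add]
    ring_nf

/-- An independent coupling suffices: the large variable is rarely below l/2 and the small one
rarely reaches l/4. The rate 15/100 is below both Chernoff exponents, (1 - log 2)/2 and 1/4 - (e -
1)/40. -/
theorem coupledUpTo_poisson_of_heavy {l μ : ℝ≥0} (h : (μ : ℝ) ≤ l / 40) :
    CoupledUpTo (ENNReal.ofReal (2 * Real.exp (-(15 / 100) * l))) (fun x y => 2 * y ≤ x)
      (poisson l) (poisson μ) := by
  set J : PMF (ℕ × ℕ) := (poisson l).bind fun x => (poisson μ).bind fun y => PMF.pure (x, y)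
  have h1 : J.map Prod.fst = poisson l := by simp [J, PMF.map_bind, PMF.pure_map]
  have h2 : J.map Prod.snd = poisson μ := by simp [J, PMF.map_bind, PMF.pure_map]
  refine ⟨J, h1, h2, ?_⟩
  calc J.toOuterMeasure {x | ¬ 2 * x.2 ≤ x.1}
      ≤ J.toOuterMeasure (Prod.fst ⁻¹' {n | (n : ℝ) < l / 2} ∪
          Prod.snd ⁻¹' {n | (l : ℝ) / 4 ≤ n}) := by
        refine MeasureTheory.measure_mono fun x hx => ?_
        by_contra hcon
        simp only [Set.mem_union, Set.mem_preimage, Set.mem_ofPred_eq, not_or, not_lt,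
          not_le] at hcon hx
        have : (x.1 : ℝ) < 2 * x.2 := by exact_mod_cast hx
        linarith [hcon.1, hcon.2]
    _ ≤ _ := MeasureTheory.measure_union_le _ _
    _ = (poisson l).toOuterMeasure {n | (n : ℝ) < l / 2} +
          (poisson μ).toOuterMeasure {n | (l : ℝ) / 4 ≤ n} := by
        rw [← PMF.toOuterMeasure_map_apply, ← PMF.toOuterMeasure_map_apply, h1, h2]
    _ ≤ ENNReal.ofReal (Real.exp (-(15 / 100) * l)) +
          ENNReal.ofReal (Real.exp (-(15 / 100) * l)) := by
        refine add_le_add ((poisson_lower_tail l _).trans (ENNReal.ofReal_le_ofReal ?_)) ?_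
        · refine Real.exp_le_exp.2 ?_
          nlinarith [Real.log_two_lt_d9, l.2]
        · refine (poisson_chernoff μ (w := Real.exp (-(l / 4))) (z := Real.exp 1)
            (Real.exp_pos _).le (Real.exp_pos _).le fun n hn => ?_).trans
              (ENNReal.ofReal_le_ofReal ?_)
          · rw [← Real.exp_nat_mul, ← Real.exp_add]
            refine Real.one_le_exp ?_
            have : (l : ℝ) / 4 ≤ n := hn
            linarith
          · rw [← Real.exp_add]
            refine Real.exp_le_exp.2 ?_
            have h3 : Real.exp 1 - 1 ≤ 2 := by linarith [Real.exp_one_lt_d9]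
            have h4 : (0 : ℝ) ≤ Real.exp 1 - 1 := by linarith [Real.exp_one_gt_d9]
            have : (μ : ℝ) * (Real.exp 1 - 1) ≤ l / 40 * 2 :=
              mul_le_mul h h3 h4 (by positivity)
            linarith [l.2]
    _ = _ := by
        rw [← ENNReal.ofReal_add (Real.exp_pos _).le (Real.exp_pos _).le, two_mul]

/-- The cases l ≤ κ and l ≥ κ. In the second one the factor l ≥ 1 is inserted for free, so that the
error is linear in the means. -/
theorem coupledUpTo_poisson {l μ : ℝ≥0} {κ : ℝ} (hκ : 10 ≤ κ)
    (h1 : (μ : ℝ) ≤ l ^ 2 / (200 * κ ^ 3)) (h2 : (μ : ℝ) ≤ l / (4 * κ)) :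
    CoupledUpTo (ENNReal.ofReal ((2 * l + 4 * μ) * Real.exp (-(15 / 100) * κ)))
      (fun x y => 2 * y ≤ x) (poisson l) (poisson μ) := by
  rcases le_total (l : ℝ) κ with h | h
  · refine (coupledUpTo_poisson_of_light (by linarith) h h1 (h2.trans ?_)).mono
      (ENNReal.ofReal_le_ofReal ?_) fun _ _ h => h
    · rw [div_le_div_iff₀ (by linarith) (by norm_num)]
      linarith
    · have := Real.exp_le_exp.2 (show -κ ≤ -(15 / 100) * κ by linarith)
      have h0 : (0 : ℝ) ≤ 4 * μ := by positivity
      have h0' : (0 : ℝ) ≤ 2 * l := by positivity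
      calc 4 * μ * Real.exp (-κ) ≤ 4 * μ * Real.exp (-(15 / 100) * κ) := by gcongr
        _ ≤ _ := by gcongr; linarith
  · refine (coupledUpTo_poisson_of_heavy (h2.trans ?_)).mono
      (ENNReal.ofReal_le_ofReal ?_) fun _ _ h => h
    · gcongr; linarith
    · have h0 : (0 : ℝ) ≤ 4 * μ := by positivity
      have : (-(15 / 100) * l : ℝ) ≤ -(15 / 100) * κ := by linarith
      gcongr
      linarith

end HalfPoisson

/-! ### One round of pairing, at the level of multiplicities -/

section Round

open scoped NNReal

variable {α : Type*} [DecidableEq α]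

theorem sum_toReal_eq_one {α : Type*} [Fintype α] (q : PMF α) : ∑ a, (q a).toReal = 1 := by
  have := q.tsum_coe
  rw [tsum_fintype] at this
  rw [← ENNReal.toReal_sum (fun a _ => q.apply_ne_top a), this]
  rfl

/-- The multiplicities are independent on both sides, so they are coupled coordinate by coordinate.
The errors add up to the total means, whatever the size of `α`. -/
theorem coupledUpTo_poissonList [Fintype α] {q Q : PMF α} {l m : ℝ≥0} {κ : ℝ} (hκ : 10 ≤ κ)
    (h1 : ∀ a, (m : ℝ) * (Q a).toReal ≤ (l * (q a).toReal) ^ 2 / (200 * κ ^ 3))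
    (h2 : ∀ a, (m : ℝ) * (Q a).toReal ≤ l * (q a).toReal / (4 * κ)) :
    CoupledUpTo (ENNReal.ofReal ((2 * l + 4 * m) * Real.exp (-(15 / 100) * κ)))
      (fun a b => ∀ x, 2 * b.count x ≤ a.count x) (poissonList l q) (poissonList m Q) := by
  have h := CoupledUpTo.piPMF (R := fun x y => 2 * y ≤ x) fun a =>
    coupledUpTo_poisson (l := l * (q a).toNNReal) (μ := m * (Q a).toNNReal) hκ
      (by push_cast; exact h1 a) (by push_cast; exact h2 a)
  rw [← poissonList_map_countVec, ← poissonList_map_countVec] at h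
  refine h.of_map_map.mono (le_of_eq ?_) fun _ _ h => h
  rw [← ENNReal.ofReal_sum_of_nonneg (fun a _ => by positivity), ← Finset.sum_mul,
    Finset.sum_add_distrib, ← Finset.mul_sum, ← Finset.mul_sum]
  push_cast
  rw [← Finset.mul_sum, ← Finset.mul_sum, sum_toReal_eq_one, sum_toReal_eq_one, mul_one, mul_one]

/-- Poissonization with room to spare: M samples contain a Poisson number of mean M/2, and a Poisson
number of mean 2M' contains M' samples. The 16κ and the 100κ² are what the two conditions of
`coupledUpTo_poissonList` then require. -/
theorem coupledUpTo_iidList_of_fintype [Fintype α] {q Q : PMF α} {M M' : ℕ} {κ qm S : ℝ}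
    (hκ : 10 ≤ κ) (hqm : ∀ a, (q a).toReal ≤ qm) (hqm0 : 0 < qm)
    (hQ : ∀ a, (Q a).toReal * S = (q a).toReal ^ 2) (hM : 100 * κ ^ 2 ≤ M * qm)
    (hM' : M' ≤ M * S / (16 * κ * qm)) (hκM' : κ ≤ M') (hM'M : M' ≤ M) :
    CoupledUpTo (ENNReal.ofReal (11 * M * Real.exp (-(15 / 100) * κ)))
      (fun a b => ∀ x, 2 * b.count x ≤ a.count x) (iidList M q) (iidList M' Q) := by
  have hM'M' : (M' : ℝ) ≤ M := by exact_mod_cast hM'M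
  have hκ0 : 0 < κ := by linarith
  have key : ∀ a, (2 * M' : ℝ) * (Q a).toReal ≤ M * (q a).toReal ^ 2 / (8 * κ * qm) := fun a => by
    calc (2 * M' : ℝ) * (Q a).toReal
        ≤ 2 * (M * S / (16 * κ * qm)) * (Q a).toReal := by gcongr
      _ = M * ((Q a).toReal * S) / (8 * κ * qm) := by field_simp; ring
      _ = _ := by rw [hQ]
  have hmid := coupledUpTo_poissonList (q := q) (Q := Q) (l := M / 2) (m := 2 * M') hκ
    (fun a => by
      push_cast
      refine (key a).trans ?_
      rw [div_le_div_iff₀ (by positivity) (by positivity)]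
      have : (M : ℝ) * (q a).toReal ^ 2 * κ * (100 * κ ^ 2) ≤
          M * (q a).toReal ^ 2 * κ * (M * qm) := by gcongr
      nlinarith [this])
    (fun a => by
      push_cast
      refine (key a).trans ?_
      rw [div_le_div_iff₀ (by positivity) (by positivity)]
      have : (M : ℝ) * (q a).toReal * κ * (q a).toReal ≤ M * (q a).toReal * κ * qm := by
        gcongr
        exact hqm a
      nlinarith [this])
  have hfst := coupledUpTo_iidList_poissonList q M (M / 2)
  have hlst := coupledUpTo_poissonList_iidList Q M' (2 * M')
  have b1 : (poisson ((M : ℝ≥0) / 2)).toOuterMeasure {K | ¬ K ≤ M} ≤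
      ENNReal.ofReal (Real.exp (-(15 / 100) * κ)) := by
    refine (poisson_chernoff _ (w := (1 / 2) ^ M) (z := 2) (by positivity)
      (by norm_num) fun n hn => ?_).trans (ENNReal.ofReal_le_ofReal ?_)
    · have : M ≤ n := (not_le.1 hn).le
      calc (1 : ℝ) = (1 / 2) ^ M * 2 ^ M := by rw [← mul_pow]; norm_num
        _ ≤ (1 / 2) ^ M * 2 ^ n := by gcongr; norm_num
    · have h2 : (1 / 2 : ℝ) ^ M = Real.exp (-(M * Real.log 2)) := by
        rw [Real.exp_neg, Real.exp_nat_mul, Real.exp_log (by norm_num), one_div, inv_pow]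
      rw [h2, ← Real.exp_add]
      refine Real.exp_le_exp.2 ?_
      push_cast
      nlinarith [Real.log_two_gt_d9]
  have b2 : (poisson (2 * (M' : ℝ≥0))).toOuterMeasure {K | ¬ M' ≤ K} ≤
      ENNReal.ofReal (Real.exp (-(15 / 100) * κ)) := by
    have := poisson_lower_tail (2 * (M' : ℝ≥0)) M'
    refine (le_trans (MeasureTheory.measure_mono fun K hK => ?_) this).trans
      (ENNReal.ofReal_le_ofReal (Real.exp_le_exp.2 ?_))
    · have : K < M' := not_le.1 hK
      exact_mod_cast this
    · push_cast
      nlinarith [Real.log_two_lt_d9]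
  refine ((hfst.trans hmid (S := fun a b => ∀ x, 2 * b.count x ≤ a.count x)
    fun a b c h h' x => (h' x).trans (h.count_le x)).trans hlst
      (S := fun a b => ∀ x, 2 * b.count x ≤ a.count x)
      fun a b c h h' x => (Nat.mul_le_mul_left 2 (h'.count_le x)).trans (h x)).mono ?_
        fun _ _ h => h
  refine (add_le_add (add_le_add b1 le_rfl) b2).trans ?_
  have e0 := Real.exp_pos (-(15 / 100) * κ)
  rw [← ENNReal.ofReal_add (by positivity) (by positivity),
    ← ENNReal.ofReal_add (by positivity) (by positivity)]
  refine ENNReal.ofReal_le_ofReal ?_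
  push_cast
  -- The three errors sum to (2 + M + 8M') exp(-(15/100) κ), and M' ≤ M with M ≥ 1.
  nlinarith

theorem PMF.exists_map_subtype_val {α : Type*} (q : PMF α) {s : Set α} (hs : q.support ⊆ s) :
    ∃ q' : PMF s, q'.map Subtype.val = q ∧ ∀ a, q' a = q a := by
  have h : ∑' a : s, q a = 1 := by
    rw [tsum_subtype_eq_of_support_subset (f := q) hs, q.tsum_coe]
  obtain ⟨q', hq'⟩ : ∃ q' : PMF s, ∀ a, q' a = q a :=
    ⟨⟨fun a => q a, h ▸ ENNReal.summable.hasSum⟩, fun _ => rfl⟩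
  refine ⟨q', ?_, hq'⟩
  ext a
  rw [PMF.map_apply]
  by_cases ha : a ∈ s
  · rw [tsum_eq_single ⟨a, ha⟩]
    · simp [hq']
    · intro b hb
      rw [if_neg]
      rintro rfl
      exact hb rfl
  · rw [(PMF.apply_eq_zero_iff q a).2 fun h => ha (hs h)]
    refine ENNReal.tsum_eq_zero.2 fun b => if_neg ?_
    rintro rfl
    exact ha b.2

theorem two_mul_count_map_le {β : Type*} [DecidableEq β] {f : β → α} (hf : Function.Injective f)
    {a b : List β} (h : ∀ x, 2 * b.count x ≤ a.count x) (x : α) :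
    2 * (b.map f).count x ≤ (a.map f).count x := by
  by_cases hx : ∃ y, f y = x
  · obtain ⟨y, rfl⟩ := hx
    rw [List.count_map_of_injective _ f hf, List.count_map_of_injective _ f hf]
    exact h y
  · rw [List.count_eq_zero_of_not_mem]
    · simp
    · intro hmem
      obtain ⟨y, -, rfl⟩ := List.mem_map.1 hmem
      exact hx ⟨y, rfl⟩

/-- Reduction to a finite type by restricting to the support. It is needed because the quotient of
the whole space by 2L has infinitely many cosets in positive dimension, of which finitely many
occur. -/
theorem coupledUpTo_iidList {q Q : PMF α} (hfin : q.support.Finite) {M M' : ℕ} {κ qm S : ℝ}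
    (hκ : 10 ≤ κ) (hqm : ∀ a, (q a).toReal ≤ qm) (hqm0 : 0 < qm) (hS : 0 < S)
    (hQ : ∀ a, (Q a).toReal * S = (q a).toReal ^ 2) (hM : 100 * κ ^ 2 ≤ M * qm)
    (hM' : M' ≤ M * S / (16 * κ * qm)) (hκM' : κ ≤ M') (hM'M : M' ≤ M) :
    CoupledUpTo (ENNReal.ofReal (11 * M * Real.exp (-(15 / 100) * κ)))
      (fun a b => ∀ x, 2 * b.count x ≤ a.count x) (iidList M q) (iidList M' Q) := by
  obtain ⟨s, hs⟩ : ∃ s, s = q.support := ⟨_, rfl⟩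
  rw [← hs] at hfin
  have := hfin.fintype
  have hsupp : Q.support ⊆ s := by
    intro a ha
    rw [hs]
    rw [PMF.mem_support_iff] at ha ⊢
    intro h0
    have := hQ a
    rw [h0] at this
    simp [hS.ne', ENNReal.toReal_eq_zero_iff, ha, Q.apply_ne_top a] at this
  obtain ⟨q', rfl, hq'⟩ := q.exists_map_subtype_val hs.ge
  obtain ⟨Q', rfl, hQ'⟩ := Q.exists_map_subtype_val hsupp
  rw [iidList_map, iidList_map]
  refine (coupledUpTo_iidList_of_fintype (q := q') (Q := Q') hκ (fun a => ?_) hqm0 (fun a => ?_)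
    hM hM' hκM' hM'M).map fun a b h x => ?_
  · rw [hq']; exact hqm a
  · rw [hq', hQ']; exact hQ a
  · exact two_mul_count_map_le Subtype.val_injective h x

end Round

/-! ### Cosets of the doubled lattice -/

section Cosets

variable {n : ℕ} {L : Submodule ℤ (Vec n)} {t : Vec n}

theorem two_zsmul_mem_doubleLattice {z : Vec n} : (2 : ℤ) • z ∈ doubleLattice L ↔ z ∈ L := by
  rw [doubleLattice, Submodule.mem_smul_pointwise_iff_exists]
  constructor
  · rintro ⟨w, hw, h⟩
    have h1 : (2 : ℝ) • w = (2 : ℝ) • z := by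
      rw [two_smul, two_smul, ← two_zsmul, ← two_zsmul]
      exact h
    have h0 : w = z := smul_right_injective _ two_ne_zero h1
    rwa [← h0]
  · intro h
    exact ⟨z, h, rfl⟩

theorem doubleLattice_le : doubleLattice L ≤ L := by
  intro x hx
  rw [doubleLattice, Submodule.mem_smul_pointwise_iff_exists] at hx
  obtain ⟨w, hw, rfl⟩ := hx
  exact L.smul_mem _ hw

theorem cosetOf_eq_iff {x y : Vec n} : cosetOf L x = cosetOf L y ↔ x - y ∈ doubleLattice L :=
  Submodule.Quotient.eq _

theorem cosetOf_add (x y : Vec n) : cosetOf L (x + y) = cosetOf L x + cosetOf L y := rfl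

theorem cosetOf_surjective : Function.Surjective (cosetOf L) := Submodule.Quotient.mk_surjective _

/-- The coset lies in the shifted lattice `L - t`. -/
def IsShiftCoset (L : Submodule ℤ (Vec n)) (t : Vec n) (q : Vec n ⧸ doubleLattice L) : Prop :=
  ∃ x ∈ shiftedLattice L t, cosetOf L x = q

theorem isShiftCoset_cosetOf {x : Vec n} :
    IsShiftCoset L t (cosetOf L x) ↔ x ∈ shiftedLattice L t := by
  constructor
  · rintro ⟨y, hy, h⟩
    have h1 := doubleLattice_le (cosetOf_eq_iff.1 h.symm)
    have h2 := L.add_mem h1 hy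
    change x + t ∈ L
    convert h2 using 1
    abel
  · exact fun h => ⟨x, h, rfl⟩

theorem isShiftCoset_add_iff {q : Vec n ⧸ doubleLattice L} {z : Vec n} (hz : z ∈ L) :
    IsShiftCoset L t (q + cosetOf L z) ↔ IsShiftCoset L t q := by
  obtain ⟨x, rfl⟩ := cosetOf_surjective q
  rw [← cosetOf_add, isShiftCoset_cosetOf, isShiftCoset_cosetOf]
  change x + z + t ∈ L ↔ x + t ∈ L
  rw [add_right_comm]
  exact L.add_mem_iff_left hz

theorem cosetSet_subset_shiftedLattice {q : Vec n ⧸ doubleLattice L} (hq : IsShiftCoset L t q) :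
    cosetSet L q ⊆ shiftedLattice L t := by
  rintro x rfl
  exact isShiftCoset_cosetOf.1 hq

theorem exists_isShiftCoset (q : Vec n ⧸ doubleLattice L) : ∃ t, IsShiftCoset L t q := by
  obtain ⟨x, rfl⟩ := cosetOf_surjective q
  exact ⟨-x, x, by simp [shiftedLattice], rfl⟩

/-- L/2L is finitely generated and killed by 2, hence finite, and the cosets in L - t form a
translate of it. -/
theorem finite_isShiftCoset [DiscreteTopology L] : {q | IsShiftCoset L t q}.Finite := by
  set S : Submodule ℤ (Vec n ⧸ doubleLattice L) := L.map (doubleLattice L).mkQ with hS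
  have hfg : Module.Finite ℤ L := inferInstance
  have : Module.Finite ℤ S := Module.Finite.map L _
  have htors : Module.IsTorsion ℤ S := by
    rintro ⟨q, hq⟩
    obtain ⟨z, hz, rfl⟩ := (Submodule.mem_map).1 hq
    refine ⟨⟨2, by simp [nonZeroDivisors]⟩, ?_⟩
    apply Subtype.ext
    change (2 : ℤ) • (doubleLattice L).mkQ z = 0
    rw [← map_zsmul]
    exact (Submodule.Quotient.mk_eq_zero _).2 (two_zsmul_mem_doubleLattice.2 hz)
  have hfin : Finite S := Module.finite_of_fg_torsion _ htors
  have hfinS : (S : Set (Vec n ⧸ doubleLattice L)).Finite := hfin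
  refine (hfinS.image fun q => q + cosetOf L (-t)).subset ?_
  rintro q ⟨x, hx, rfl⟩
  refine ⟨cosetOf L (x + t), Submodule.mem_map_of_mem hx, ?_⟩
  change cosetOf L (x + t) + cosetOf L (-t) = _
  rw [← cosetOf_add]
  simp

end Cosets

/-! ### Gaussian masses -/

section Mass

variable {n : ℕ} {L : Submodule ℤ (Vec n)} {t : Vec n} {s s' : ℝ}

/-- The Gaussian mass of a vector, as an extended nonnegative number. -/
def gMass (s : ℝ) (x : Vec n) : ℝ≥0∞ := ENNReal.ofReal (gaussianMass s x)

/-- The Gaussian mass of a set, as an extended nonnegative number. -/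
def gMassSet (s : ℝ) (A : Set (Vec n)) : ℝ≥0∞ := ∑' x, A.indicator (gMass s) x

theorem gMass_ne_zero (x : Vec n) : gMass s x ≠ 0 := by
  simp [gMass, gaussianMass, Real.exp_pos]

theorem gMassSet_mono {A B : Set (Vec n)} (h : A ⊆ B) : gMassSet s A ≤ gMassSet s B :=
  ENNReal.tsum_le_tsum fun _ => Set.indicator_le_indicator_of_subset h (fun _ => zero_le) _

theorem gaussianMassSet_eq_toReal (A : Set (Vec n)) :
    gaussianMassSet s A = (gMassSet s A).toReal := by
  rw [gMassSet, ← tsum_subtype]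
  simp only [gMass]
  rw [ENNReal.tsum_toReal_eq fun _ => ENNReal.ofReal_ne_top]
  exact tsum_congr fun x => (ENNReal.toReal_ofReal (Real.exp_pos _).le).symm

theorem gMassSet_ne_zero {A : Set (Vec n)} (hA : A.Nonempty) : gMassSet s A ≠ 0 := by
  obtain ⟨x, hx⟩ := hA
  intro h
  have := ENNReal.tsum_eq_zero.1 h x
  rw [Set.indicator_of_mem hx] at this
  exact gMass_ne_zero x this

theorem gMassSet_ne_top [DiscreteTopology L] (hs : 0 < s) {A : Set (Vec n)}
    (hA : A ⊆ shiftedLattice L t) : gMassSet s A ≠ ∞ := by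
  rw [gMassSet, ← tsum_subtype]
  exact (summable_gaussianMass L t hs hA).tsum_ofReal_ne_top

theorem discreteGaussian_eq [DiscreteTopology L] (hs : 0 < s) {A : Set (Vec n)}
    (hne : A.Nonempty) (hA : A ⊆ shiftedLattice L t) (x : Vec n) :
    discreteGaussian s A x = A.indicator (gMass s) x * (gMassSet s A)⁻¹ := by
  have h : (∑' x, A.indicator (fun y => ENNReal.ofReal (gaussianMass s y)) x) ≠ 0 ∧
      (∑' x, A.indicator (fun y => ENNReal.ofReal (gaussianMass s y)) x) ≠ ∞ :=
    ⟨gMassSet_ne_zero hne, gMassSet_ne_top hs hA⟩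
  rw [discreteGaussian, dif_pos h, PMF.normalize_apply]
  rfl

theorem eq_discreteGaussian [DiscreteTopology L] (hs : 0 < s) {A : Set (Vec n)}
    (hne : A.Nonempty) (hA : A ⊆ shiftedLattice L t) {μ : PMF (Vec n)} {c : ℝ≥0∞}
    (h : ∀ x, μ x = c * A.indicator (gMass s) x) :
    c * gMassSet s A = 1 ∧ μ = discreteGaussian s A := by
  have h1 : c * gMassSet s A = 1 := by
    rw [gMassSet, ← ENNReal.tsum_mul_left, ← μ.tsum_coe]
    exact tsum_congr fun x => (h x).symm
  refine ⟨h1, ?_⟩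
  ext x
  rw [discreteGaussian_eq hs hne hA, h, mul_comm, ENNReal.eq_inv_of_mul_eq_one_left h1]

theorem shiftedLattice_nonempty : (shiftedLattice L t).Nonempty :=
  ⟨-t, by simp [shiftedLattice]⟩

theorem cosetSet_nonempty (q : Vec n ⧸ doubleLattice L) : (cosetSet L q).Nonempty :=
  cosetOf_surjective q

/-- The discrete Gaussian on a coset. -/
def cosetGaussian (L : Submodule ℤ (Vec n)) (s : ℝ) (q : Vec n ⧸ doubleLattice L) :
    PMF (Vec n) := discreteGaussian s (cosetSet L q)

theorem gMassSet_cosetSet_ne_top [DiscreteTopology L] (hs : 0 < s)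
    (q : Vec n ⧸ doubleLattice L) : gMassSet s (cosetSet L q) ≠ ∞ := by
  obtain ⟨t, ht⟩ := exists_isShiftCoset q
  exact gMassSet_ne_top hs (cosetSet_subset_shiftedLattice ht)

theorem cosetGaussian_apply [DiscreteTopology L] (hs : 0 < s) (q : Vec n ⧸ doubleLattice L)
    (x : Vec n) : cosetGaussian L s q x =
      (cosetSet L q).indicator (gMass s) x * (gMassSet s (cosetSet L q))⁻¹ := by
  obtain ⟨t, ht⟩ := exists_isShiftCoset q
  exact discreteGaussian_eq hs (cosetSet_nonempty q) (cosetSet_subset_shiftedLattice ht) x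

theorem cosetOf_eq_of_mem_support [DiscreteTopology L] (hs : 0 < s)
    {q : Vec n ⧸ doubleLattice L} {x : Vec n} (hx : x ∈ (cosetGaussian L s q).support) :
    cosetOf L x = q := by
  by_contra h
  rw [PMF.mem_support_iff, cosetGaussian_apply hs, Set.indicator_of_notMem (by exact h),
    zero_mul] at hx
  exact hx rfl

theorem map_cosetOf_apply {μ : PMF (Vec n)} {h : Vec n ⧸ doubleLattice L → ℝ≥0∞}
    (hμ : ∀ x, μ x = h (cosetOf L x) * gMass s x) (q : Vec n ⧸ doubleLattice L) :
    (μ.map (cosetOf L)) q = h q * gMassSet s (cosetSet L q) := by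
  classical
  rw [PMF.map_apply, gMassSet, ← ENNReal.tsum_mul_left]
  refine tsum_congr fun x => ?_
  by_cases hx : cosetOf L x = q
  · subst hx
    rw [if_pos rfl, Set.indicator_of_mem (by rfl), hμ]
  · rw [if_neg (Ne.symm hx), Set.indicator_of_notMem (by exact hx), mul_zero]

/-- A distribution that is proportional to the Gaussian mass on every coset is a mixture. -/
theorem eq_bind_cosetGaussian [DiscreteTopology L] (hs : 0 < s) {μ : PMF (Vec n)}
    {h : Vec n ⧸ doubleLattice L → ℝ≥0∞} (hμ : ∀ x, μ x = h (cosetOf L x) * gMass s x) :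
    μ = (μ.map (cosetOf L)).bind (cosetGaussian L s) := by
  ext x
  rw [PMF.bind_apply, tsum_eq_single (cosetOf L x)]
  · rw [map_cosetOf_apply hμ, cosetGaussian_apply hs, Set.indicator_of_mem (by rfl), hμ,
      mul_comm (gMass s x), mul_assoc, ← mul_assoc (gMassSet _ _),
      ENNReal.mul_inv_cancel (gMassSet_ne_zero (cosetSet_nonempty _))
        (gMassSet_cosetSet_ne_top hs _), one_mul]
  · intro q hq
    rw [cosetGaussian_apply hs, Set.indicator_of_notMem (by exact hq.symm), zero_mul, mul_zero]

/-- The coset law of the discrete Gaussian on the shifted lattice. -/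
def shiftLaw (L : Submodule ℤ (Vec n)) (t : Vec n) (s : ℝ) : PMF (Vec n ⧸ doubleLattice L) :=
  (discreteGaussian s (shiftedLattice L t)).map (cosetOf L)

open Classical in
theorem discreteGaussian_shiftedLattice_apply [DiscreteTopology L] (hs : 0 < s) (x : Vec n) :
    discreteGaussian s (shiftedLattice L t) x =
      (if IsShiftCoset L t (cosetOf L x) then (gMassSet s (shiftedLattice L t))⁻¹ else 0) *
        gMass s x := by
  rw [discreteGaussian_eq hs shiftedLattice_nonempty le_rfl, isShiftCoset_cosetOf, Set.indicator]
  split_ifs <;> simp [mul_comm]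

theorem bind_shiftLaw [DiscreteTopology L] (hs : 0 < s) :
    (shiftLaw L t s).bind (cosetGaussian L s) = discreteGaussian s (shiftedLattice L t) := by
  classical
  exact (eq_bind_cosetGaussian (h := fun q => if IsShiftCoset L t q then
    (gMassSet s (shiftedLattice L t))⁻¹ else 0) hs
      (discreteGaussian_shiftedLattice_apply hs)).symm

open Classical in
theorem shiftLaw_apply [DiscreteTopology L] (hs : 0 < s) (q : Vec n ⧸ doubleLattice L) :
    shiftLaw L t s q = if IsShiftCoset L t q then
      gMassSet s (cosetSet L q) * (gMassSet s (shiftedLattice L t))⁻¹ else 0 := by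
  rw [shiftLaw, map_cosetOf_apply (h := fun q => if IsShiftCoset L t q then
    (gMassSet s (shiftedLattice L t))⁻¹ else 0) (discreteGaussian_shiftedLattice_apply hs)]
  split_ifs <;> simp [mul_comm]

theorem support_shiftLaw [DiscreteTopology L] (hs : 0 < s) :
    (shiftLaw L t s).support ⊆ {q | IsShiftCoset L t q} := by
  classical
  intro q hq
  by_contra h
  rw [PMF.mem_support_iff, shiftLaw_apply hs, if_neg (by exact h)] at hq
  exact hq rfl

/-! ### Averages of two vectors of a coset -/

theorem gMass_mul_gMass (hss : s ^ 2 = 2 * s' ^ 2) (hs' : s' ≠ 0) (x y : Vec n) :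
    gMass s (y + x) * gMass s (y - x) = gMass s' y * gMass s' x := by
  have hpar := parallelogram_law_with_norm ℝ y x
  simp only [gMass, gaussianMass]
  rw [← ENNReal.ofReal_mul (Real.exp_pos _).le, ← ENNReal.ofReal_mul (Real.exp_pos _).le,
    ← Real.exp_add, ← Real.exp_add, hss]
  congr 2
  field_simp
  linarith

open Classical in
/-- The mass of the lattice vectors that lead from the coset `d` to the coset `q`. -/
def transferMass (L : Submodule ℤ (Vec n)) (s : ℝ) (q d : Vec n ⧸ doubleLattice L) : ℝ≥0∞ :=
  ∑' z, if z ∈ L ∧ d + cosetOf L z = q then gMass s z else 0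

/-- The law of the average of two independent samples. -/
def averageLaw {β : Type*} (G : β → PMF (Vec n)) (q : β) : PMF (Vec n) :=
  (G q).bind fun x => (G q).map fun y => (1 / 2 : ℝ) • (x + y)

/-- The vectors y + z and y - z differ by 2z, which lies in 2L exactly when z ∈ L. -/
theorem cosetOf_add_eq_and_sub_eq_iff {q : Vec n ⧸ doubleLattice L} {y z : Vec n} :
    cosetOf L (y + z) = q ∧ cosetOf L (y - z) = q ↔ z ∈ L ∧ cosetOf L y + cosetOf L z = q := by
  rw [← cosetOf_add]
  have key : cosetOf L (y + z) = cosetOf L (y - z) ↔ z ∈ L := by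
    rw [cosetOf_eq_iff, ← two_zsmul_mem_doubleLattice (L := L)]
    have : y + z - (y - z) = (2 : ℤ) • z := by rw [two_zsmul]; abel
    rw [this]
  constructor
  · rintro ⟨h1, h2⟩
    exact ⟨key.1 (h1.trans h2.symm), h1⟩
  · rintro ⟨h1, h2⟩
    exact ⟨h2, (key.2 h1).symm.trans h2⟩

/-- Two samples with average y are y + z and y - z. Their joint mass factors by `gMass_mul_gMass`,
and the coset condition on z depends on y only through its coset. -/
theorem averageLaw_cosetGaussian_apply [DiscreteTopology L] (hs : 0 < s)
    (hss : s ^ 2 = 2 * s' ^ 2) (hs' : s' ≠ 0) (q : Vec n ⧸ doubleLattice L) (y : Vec n) :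
    averageLaw (cosetGaussian L s) q y =
      (gMassSet s (cosetSet L q))⁻¹ ^ 2 * transferMass L s' q (cosetOf L y) * gMass s' y := by
  classical
  have h1 : averageLaw (cosetGaussian L s) q y =
      ∑' x, cosetGaussian L s q x * cosetGaussian L s q ((2 : ℝ) • y - x) := by
    rw [averageLaw, PMF.bind_apply]
    refine tsum_congr fun x => ?_
    congr 1
    rw [PMF.map_apply, tsum_eq_single ((2 : ℝ) • y - x)]
    · rw [if_pos]
      rw [add_sub_cancel, smul_smul]
      norm_num
    · intro z hz
      rw [if_neg]
      rintro rfl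
      apply hz
      rw [smul_smul]
      norm_num
  -- The substitution x = y + z turns the second sample 2y - x into y - z.
  rw [h1, ← (Equiv.addLeft y).tsum_eq, transferMass, ← ENNReal.tsum_mul_left,
    ← ENNReal.tsum_mul_right]
  refine tsum_congr fun z => ?_
  have e : (2 : ℝ) • y - (Equiv.addLeft y) z = y - z := by
    change (2 : ℝ) • y - (y + z) = y - z
    rw [two_smul ℝ y, add_sub_add_left_eq_sub]
  rw [e, Equiv.coe_addLeft, cosetGaussian_apply hs, cosetGaussian_apply hs]
  by_cases hz : z ∈ L ∧ cosetOf L y + cosetOf L z = q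
  · obtain ⟨ha, hb⟩ := cosetOf_add_eq_and_sub_eq_iff.2 hz
    rw [if_pos hz, Set.indicator_of_mem (by exact ha), Set.indicator_of_mem (by exact hb)]
    calc _ = (gMassSet s (cosetSet L q))⁻¹ ^ 2 * (gMass s (y + z) * gMass s (y - z)) := by ring
      _ = _ := by rw [gMass_mul_gMass hss hs']; ring
  · rw [if_neg hz, mul_zero, zero_mul]
    rw [← cosetOf_add_eq_and_sub_eq_iff, not_and_or] at hz
    rcases hz with hz | hz
    · rw [Set.indicator_of_notMem (by exact hz), zero_mul, zero_mul]
    · rw [Set.indicator_of_notMem (a := y - z) (by exact hz), zero_mul, mul_zero]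

/-- The coset law of the average of two samples from a coset. -/
def averageCosetLaw (L : Submodule ℤ (Vec n)) (s : ℝ) (q : Vec n ⧸ doubleLattice L) :
    PMF (Vec n ⧸ doubleLattice L) :=
  (averageLaw (cosetGaussian L s) q).map (cosetOf L)

theorem bind_averageCosetLaw [DiscreteTopology L] (hs : 0 < s) (hs' : 0 < s')
    (hss : s ^ 2 = 2 * s' ^ 2) (q : Vec n ⧸ doubleLattice L) :
    (averageCosetLaw L s q).bind (cosetGaussian L s') = averageLaw (cosetGaussian L s) q :=
  (eq_bind_cosetGaussian hs' (h := fun d => (gMassSet s (cosetSet L q))⁻¹ ^ 2 *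
    transferMass L s' q d) (averageLaw_cosetGaussian_apply hs hss hs'.ne' q)).symm

theorem isShiftCoset_of_mem_support_averageCosetLaw [DiscreteTopology L] (hs : 0 < s)
    (hs' : 0 < s') (hss : s ^ 2 = 2 * s' ^ 2) {q d : Vec n ⧸ doubleLattice L}
    (hq : IsShiftCoset L t q) (hd : d ∈ (averageCosetLaw L s q).support) :
    IsShiftCoset L t d := by
  classical
  obtain ⟨y, hy, rfl⟩ := (PMF.mem_support_map_iff _ _ _).1 hd
  rw [PMF.mem_support_iff, averageLaw_cosetGaussian_apply hs hss hs'.ne'] at hy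
  have hT : transferMass L s' q (cosetOf L y) ≠ 0 := by
    intro h; simp [h] at hy
  rw [transferMass] at hT
  obtain ⟨z, hz⟩ := not_forall.1 fun h => hT (ENNReal.tsum_eq_zero.2 h)
  have hz' : z ∈ L ∧ cosetOf L y + cosetOf L z = q := by
    by_contra h
    exact hz (if_neg h)
  rw [← hz'.2] at hq
  exact (isShiftCoset_add_iff hz'.1).1 hq

/-! ### The squared coset law -/

/-- The collision probability of the coset law. -/
def collisionMass (L : Submodule ℤ (Vec n)) (t : Vec n) (s : ℝ) : ℝ≥0∞ :=
  ∑' q, shiftLaw L t s q ^ 2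

theorem collisionMass_ne_zero : collisionMass L t s ≠ 0 := by
  obtain ⟨q, hq⟩ := (shiftLaw L t s).support_nonempty
  intro h
  have := ENNReal.tsum_eq_zero.1 h q
  exact hq (pow_eq_zero_iff (by norm_num) |>.1 this)

theorem collisionMass_le_one : collisionMass L t s ≤ 1 := by
  rw [← (shiftLaw L t s).tsum_coe]
  refine ENNReal.tsum_le_tsum fun q => ?_
  rw [sq]
  exact mul_le_of_le_one_left zero_le ((shiftLaw L t s).coe_le_one q)

theorem collisionMass_ne_top : collisionMass L t s ≠ ∞ :=
  (collisionMass_le_one.trans_lt ENNReal.one_lt_top).ne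

/-- The law that gives a coset probability proportional to the square of its original
probability. -/
def squaredLaw (L : Submodule ℤ (Vec n)) (t : Vec n) (s : ℝ) : PMF (Vec n ⧸ doubleLattice L) :=
  PMF.normalize (fun q => shiftLaw L t s q ^ 2) collisionMass_ne_zero collisionMass_ne_top

theorem squaredLaw_apply (q : Vec n ⧸ doubleLattice L) :
    squaredLaw L t s q = shiftLaw L t s q ^ 2 * (collisionMass L t s)⁻¹ := rfl

-- Each z ∈ L leads from d to exactly one coset, which is in L - t if and only if d is. The total is
-- therefore the same for all cosets d of L - t.
open Classical in
theorem tsum_transferMass (d : Vec n ⧸ doubleLattice L) :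
    ∑' q, (if IsShiftCoset L t q then transferMass L s q d else 0) =
      if IsShiftCoset L t d then gMassSet s (L : Set (Vec n)) else 0 := by
  have h1 : ∀ q, (if IsShiftCoset L t q then transferMass L s q d else 0) =
      ∑' z, if IsShiftCoset L t q ∧ z ∈ L ∧ d + cosetOf L z = q then gMass s z else 0 := by
    intro q
    split_ifs with h
    · simp [transferMass, h]
    · simp [h]
  simp_rw [h1]
  rw [ENNReal.tsum_comm]
  split_ifs with h
  · rw [gMassSet]
    refine tsum_congr fun z => ?_
    rw [tsum_eq_single (d + cosetOf L z)]
    · by_cases hz : z ∈ L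
      · simp [hz, isShiftCoset_add_iff hz, h]
      · simp [hz]
    · intro q hq
      rw [if_neg]
      rintro ⟨-, -, rfl⟩
      exact hq rfl
  · refine ENNReal.tsum_eq_zero.2 fun z => ENNReal.tsum_eq_zero.2 fun q => if_neg ?_
    rintro ⟨h2, hz, rfl⟩
    exact h ((isShiftCoset_add_iff hz).1 h2)

/-- The squared probability of q cancels the squared normaliser of the coset Gaussian, and what
remains sums by `tsum_transferMass` to a constant multiple of ρ_{s'} on L - t. That the total mass
is 1 gives the formula for the collision probability. -/
theorem bind_squaredLaw_aux [DiscreteTopology L] (hs : 0 < s) (hs' : 0 < s')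
    (hss : s ^ 2 = 2 * s' ^ 2) :
    (collisionMass L t s)⁻¹ * (gMassSet s (shiftedLattice L t))⁻¹ ^ 2 *
      gMassSet s' (L : Set (Vec n)) * gMassSet s' (shiftedLattice L t) = 1 ∧
    (squaredLaw L t s).bind (averageLaw (cosetGaussian L s)) =
      discreteGaussian s' (shiftedLattice L t) := by
  classical
  refine eq_discreteGaussian hs' shiftedLattice_nonempty le_rfl fun y => ?_
  rw [PMF.bind_apply]
  have h1 : ∀ q, squaredLaw L t s q * averageLaw (cosetGaussian L s) q y =
      (if IsShiftCoset L t q then transferMass L s' q (cosetOf L y) else 0) *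
        ((collisionMass L t s)⁻¹ * (gMassSet s (shiftedLattice L t))⁻¹ ^ 2 * gMass s' y) := by
    intro q
    rw [squaredLaw_apply, shiftLaw_apply hs, averageLaw_cosetGaussian_apply hs hss hs'.ne']
    split_ifs with h
    · have hc : gMassSet s (cosetSet L q) * (gMassSet s (cosetSet L q))⁻¹ = 1 :=
        ENNReal.mul_inv_cancel (gMassSet_ne_zero (cosetSet_nonempty _))
          (gMassSet_cosetSet_ne_top hs _)
      calc _ = (gMassSet s (cosetSet L q) * (gMassSet s (cosetSet L q))⁻¹) ^ 2 *
            (transferMass L s' q (cosetOf L y) * ((collisionMass L t s)⁻¹ *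
              (gMassSet s (shiftedLattice L t))⁻¹ ^ 2 * gMass s' y)) := by ring
        _ = _ := by rw [hc, one_pow, one_mul]
    · simp
  simp_rw [h1]
  rw [ENNReal.tsum_mul_right, tsum_transferMass, isShiftCoset_cosetOf, Set.indicator]
  split_ifs
  · ring
  · simp

theorem bind_squaredLaw [DiscreteTopology L] (hs : 0 < s) (hs' : 0 < s')
    (hss : s ^ 2 = 2 * s' ^ 2) :
    (squaredLaw L t s).bind (averageCosetLaw L s) = shiftLaw L t s' := by
  rw [shiftLaw, ← (bind_squaredLaw_aux (t := t) hs hs' hss).2, PMF.map_bind]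
  rfl

/-- The masses of cosets decrease at most quadratically when the parameter does. -/
theorem gMassSet_sq_le [DiscreteTopology L] (hs : 0 < s) (hs' : 0 < s')
    (hss : s ^ 2 = 2 * s' ^ 2) {q : Vec n ⧸ doubleLattice L} (hq : IsShiftCoset L t q)
    {B : ℝ≥0∞} (hB : ∀ d, IsShiftCoset L t d → gMassSet s' (cosetSet L d) ≤ B) :
    gMassSet s (cosetSet L q) ^ 2 ≤ gMassSet s' (L : Set (Vec n)) * B := by
  classical
  have h0 : gMassSet s (cosetSet L q) ≠ 0 := gMassSet_ne_zero (cosetSet_nonempty _)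
  have h1 : gMassSet s (cosetSet L q) ≠ ∞ := gMassSet_cosetSet_ne_top hs _
  -- This says that the law of the average of two samples from q has total mass 1.
  have h2 : gMassSet s (cosetSet L q) ^ 2 =
      ∑' y, transferMass L s' q (cosetOf L y) * gMass s' y := by
    have h3 := (averageLaw (cosetGaussian L s) q).tsum_coe
    simp_rw [averageLaw_cosetGaussian_apply hs hss hs'.ne' q, mul_assoc] at h3
    rw [ENNReal.tsum_mul_left] at h3
    calc gMassSet s (cosetSet L q) ^ 2 = gMassSet s (cosetSet L q) ^ 2 * 1 := (mul_one _).symm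
      _ = (gMassSet s (cosetSet L q) * (gMassSet s (cosetSet L q))⁻¹) ^ 2 *
          ∑' y, transferMass L s' q (cosetOf L y) * gMass s' y := by
        rw [← h3, mul_pow, mul_assoc]
      _ = _ := by rw [ENNReal.mul_inv_cancel h0 h1, one_pow, one_mul]
  rw [h2]
  simp_rw [transferMass, ← ENNReal.tsum_mul_right]
  -- After the interchange each z ∈ L contributes ρ_{s'}(z) times the mass of the coset q - z, which
  -- is at most `B`.
  rw [ENNReal.tsum_comm, gMassSet, ← ENNReal.tsum_mul_right]
  refine ENNReal.tsum_le_tsum fun z => ?_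
  by_cases hz : z ∈ L
  · rw [Set.indicator_of_mem (by exact hz)]
    obtain ⟨x, rfl⟩ := cosetOf_surjective q
    have hd : IsShiftCoset L t (cosetOf L (x - z)) := by
      rw [← isShiftCoset_add_iff hz, ← cosetOf_add, sub_add_cancel]
      exact hq
    refine le_trans (le_of_eq ?_) (mul_le_mul_right (hB _ hd) (gMass s' z))
    rw [gMassSet, ← ENNReal.tsum_mul_left]
    refine tsum_congr fun y => ?_
    have : cosetOf L y + cosetOf L z = cosetOf L x ↔ y ∈ cosetSet L (cosetOf L (x - z)) := by
      change _ ↔ cosetOf L y = cosetOf L (x - z)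
      rw [← cosetOf_add, cosetOf_eq_iff, cosetOf_eq_iff]
      have : y + z - x = y - (x - z) := by abel
      rw [this]
    by_cases hy : y ∈ cosetSet L (cosetOf L (x - z))
    · rw [if_pos ⟨hz, this.2 hy⟩, Set.indicator_of_mem hy]
    · rw [if_neg fun h => hy (this.1 h.2), Set.indicator_of_notMem hy, zero_mul, mul_zero]
  · simp [hz]

end Mass

/-! ### Mixtures of independent Gaussians -/

section Mixture

variable {n : ℕ} {L : Submodule ℤ (Vec n)} {t : Vec n} {s s' : ℝ}

/-- Independent samples from the distributions that a random list of indices prescribes. -/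
def mixtureOf {β γ : Type*} (G : β → PMF γ) (ν : PMF (List β)) : PMF (List γ) :=
  ν.bind fun c => independentList (c.map G)

theorem map_eq_of_mem_support_independentList {β γ : Type*} {G : β → PMF γ} {f : γ → β}
    (hG : ∀ b, ∀ x ∈ (G b).support, f x = b) {c : List β} {l : List γ}
    (hl : l ∈ (independentList (c.map G)).support) : l.map f = c := by
  have h := mem_support_independentList hl
  rw [List.forall₂_map_right_iff] at h
  induction h with
  | nil => rfl
  | cons hx _ ih =>
    rw [List.map_cons, hG _ _ hx, ih ?_]
    rw [List.map_cons, independentList_cons, PMF.mem_support_bind_iff] at hl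
    obtain ⟨x, -, hl⟩ := hl
    obtain ⟨l', hl', hl⟩ := (PMF.mem_support_bind_iff _ _ _).1 hl
    rw [PMF.mem_support_pure_iff] at hl
    rw [(List.cons.inj hl).2]
    exact hl'

theorem map_map_mixtureOf {β γ : Type*} {G : β → PMF γ} {f : γ → β}
    (hG : ∀ b, ∀ x ∈ (G b).support, f x = b) (ν : PMF (List β)) :
    (mixtureOf G ν).map (List.map f) = ν := by
  rw [mixtureOf, PMF.map_bind]
  conv_rhs => rw [← PMF.bind_pure ν]
  refine PMF.bind_congr' fun c _ => ?_
  rw [PMF.map_congr' (g := fun _ => c) fun l hl => map_eq_of_mem_support_independentList hG hl]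
  exact PMF.map_const _ _

theorem mixtureOf_apply {β γ : Type*} {G : β → PMF γ} {f : γ → β}
    (hG : ∀ b, ∀ x ∈ (G b).support, f x = b) (ν : PMF (List β)) (l : List γ) :
    mixtureOf G ν l = ν (l.map f) * independentList ((l.map f).map G) l := by
  rw [mixtureOf, PMF.bind_apply, tsum_eq_single (l.map f)]
  intro c hc
  rw [(PMF.apply_eq_zero_iff _ l).2, mul_zero]
  intro hl
  exact hc (map_eq_of_mem_support_independentList hG hl).symm

/-- As `f` recovers the index from a sample, only c itself produces lists over c, and conditioning
divides by its probability. -/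
theorem filter_mixtureOf {β γ : Type*} {G : β → PMF γ} {f : γ → β}
    (hG : ∀ b, ∀ x ∈ (G b).support, f x = b) (ν : PMF (List β)) (c : List β)
    (h : ∃ l ∈ {l : List γ | l.map f = c}, l ∈ (mixtureOf G ν).support) :
    (mixtureOf G ν).filter {l | l.map f = c} h = independentList (c.map G) := by
  have hc0 : ν c ≠ 0 := by
    obtain ⟨l, rfl, hl⟩ := h
    rw [PMF.mem_support_iff, mixtureOf_apply hG] at hl
    exact left_ne_zero_of_mul hl
  have hind : ∀ l, ({l : List γ | l.map f = c} : Set (List γ)).indicator (mixtureOf G ν) l =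
      ν c * independentList (c.map G) l := by
    intro l
    by_cases hl : l.map f = c
    · rw [Set.indicator_of_mem (by exact hl), mixtureOf_apply hG, hl]
    · rw [Set.indicator_of_notMem (by exact hl), (PMF.apply_eq_zero_iff _ l).2, mul_zero]
      exact fun h => hl (map_eq_of_mem_support_independentList hG h)
  ext l
  rw [PMF.filter_apply, hind]
  simp_rw [hind]
  rw [ENNReal.tsum_mul_left, PMF.tsum_coe, mul_one, mul_right_comm,
    ENNReal.mul_inv_cancel hc0 (ν.apply_ne_top c), one_mul]

theorem isGaussianMixture_mixtureOf [DiscreteTopology L] (hs : 0 < s)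
    {ν : PMF (List (Vec n ⧸ doubleLattice L))}
    (hν : ∀ c ∈ ν.support, ∀ q ∈ c, IsShiftCoset L t q) :
    IsGaussianMixture L t s (mixtureOf (cosetGaussian L s) ν) where
  mem_shiftedLattice := by
    intro l hl x hx
    have h1 : l.map (cosetOf L) ∈ ν.support := by
      rw [PMF.mem_support_iff, mixtureOf_apply fun _ _ hx => cosetOf_eq_of_mem_support hs hx] at hl
      exact left_ne_zero_of_mul hl
    exact isShiftCoset_cosetOf.1 (hν _ h1 _ (List.mem_map_of_mem hx))
  filter_eq := fun c h => filter_mixtureOf (fun _ _ hx => cosetOf_eq_of_mem_support hs hx) ν c h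

theorem cosetDistribution_mixtureOf [DiscreteTopology L] (hs : 0 < s)
    (ν : PMF (List (Vec n ⧸ doubleLattice L))) :
    cosetDistribution L (mixtureOf (cosetGaussian L s) ν) = ν :=
  map_map_mixtureOf (fun _ _ hx => cosetOf_eq_of_mem_support hs hx) ν

theorem iidList_discreteGaussian [DiscreteTopology L] (hs : 0 < s) (M : ℕ) :
    iidList M (discreteGaussian s (shiftedLattice L t)) =
      mixtureOf (cosetGaussian L s) (iidList M (shiftLaw L t s)) := by
  rw [← bind_shiftLaw hs, iidList_bind]
  rfl

theorem CoupledUpTo.mixtureOf {β γ : Type*} {ε : ℝ≥0∞} {μ ν : PMF (List β)} (G : β → PMF γ)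
    (h : CoupledUpTo ε Eq μ ν) : CoupledUpTo ε Eq (mixtureOf G μ) (_root_.mixtureOf G ν) :=
  h.bind fun _ _ hab => hab ▸ CoupledUpTo.refl (fun _ => rfl) _

/-! ### Pairing and averaging a mixture -/

theorem pairAndAverage_nil : pairAndAverage L [] = [] := by rw [pairAndAverage]

theorem pairAndAverage_cons_of_notMem {x : Vec n} {l : List (Vec n)}
    (h : ∀ y ∈ l, cosetOf L y ≠ cosetOf L x) :
    pairAndAverage L (x :: l) = pairAndAverage L l := by
  rw [pairAndAverage, List.find?_eq_none.2 (by simpa using h)]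

theorem pairAndAverage_cons_append {x y : Vec n} {l₁ l₂ : List (Vec n)}
    (h : ∀ z ∈ l₁, cosetOf L z ≠ cosetOf L x) (hy : cosetOf L y = cosetOf L x) :
    pairAndAverage L (x :: (l₁ ++ y :: l₂)) =
      (1 / 2 : ℝ) • (x + y) :: pairAndAverage L (l₁ ++ l₂) := by
  rw [pairAndAverage, List.find?_append, List.find?_eq_none.2 (by simpa using h),
    List.find?_cons_of_pos (by simpa using hy), List.eraseP_append_right _ (by simpa using h),
    List.eraseP_cons_of_pos (by simpa using hy)]
  rfl

-- The procedure inspects only cosets, which are fixed by c. So the partner of each entry has a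
-- known position, and the paired samples are independent of all others.
open Classical in
theorem map_pairAndAverage_independentList {G : Vec n ⧸ doubleLattice L → PMF (Vec n)}
    (hG : ∀ q, ∀ x ∈ (G q).support, cosetOf L x = q) (c : List (Vec n ⧸ doubleLattice L)) :
    (independentList (c.map G)).map (pairAndAverage L) =
      independentList ((pairedList c).map (averageLaw G)) := by
  induction hn : c.length using Nat.strong_induction_on generalizing c with
  | _ n ih =>
    cases c with
    | nil => simp [pairedList_nil, independentList_nil, PMF.pure_map, pairAndAverage_nil]
    | cons q c =>
      simp only [List.length_cons] at hn
      by_cases hq : q ∈ c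
      · obtain ⟨c₁, c₂, rfl, hc₁⟩ := List.eq_append_cons_of_mem hq
        have herase : (c₁ ++ q :: c₂).erase q = c₁ ++ c₂ := by
          rw [List.erase_append_right _ hc₁, List.erase_cons_head]
        rw [pairedList_cons_of_mem hq, herase, List.map_cons, List.map_cons, independentList_cons,
          independentList_cons, ← ih (c₁ ++ c₂).length (by simp at hn ⊢; omega) _ rfl,
          List.map_append, List.map_append, List.map_cons, independentList_append,
          independentList_append, independentList_cons, averageLaw]
        simp only [PMF.map_bind, PMF.bind_bind, PMF.bind_map, PMF.pure_bind, PMF.pure_map,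
          Function.comp_def]
        refine PMF.bind_congr' fun x hx => ?_
        -- In the list the partner y is drawn after the entries `l₁` before it; in the average it is
        -- drawn right after x. Independence allows the exchange.
        rw [PMF.bind_comm (G q)]
        refine PMF.bind_congr' fun l₁ hl₁ => ?_
        refine PMF.bind_congr' fun y hy => ?_
        refine PMF.bind_congr' fun l₂ _ => ?_
        rw [pairAndAverage_cons_append]
        · intro z hz h
          have := List.mem_map_of_mem (f := cosetOf L) hz
          rw [map_eq_of_mem_support_independentList hG hl₁, h, hG q x hx] at this
          exact hc₁ this
        · rw [hG q x hx, hG q y hy]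
      · rw [pairedList_cons_of_notMem hq, ← ih c.length (by omega) c rfl, List.map_cons,
          independentList_cons]
        simp only [PMF.map_bind, PMF.pure_map]
        -- The dropped entry is reinserted as a draw that has no effect.
        conv_rhs => rw [← PMF.bind_const (G q) (PMF.map _ _)]
        refine PMF.bind_congr' fun x hx => ?_
        refine PMF.bind_congr' fun l hl => ?_
        rw [pairAndAverage_cons_of_notMem]
        · rfl
        · intro z hz h
          have := List.mem_map_of_mem (f := cosetOf L) hz
          rw [map_eq_of_mem_support_independentList hG hl, h, hG q x hx] at this
          exact hq this

open Classical in
/-- One round of pair-and-average, at the level of cosets. -/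
def nextCosets (L : Submodule ℤ (Vec n)) (s : ℝ) (ν : PMF (List (Vec n ⧸ doubleLattice L))) :
    PMF (List (Vec n ⧸ doubleLattice L)) :=
  (ν.map pairedList).bind fun l => independentList (l.map (averageCosetLaw L s))

theorem map_pairAndAverage_mixtureOf [DiscreteTopology L] (hs : 0 < s) (hs' : 0 < s')
    (hss : s ^ 2 = 2 * s' ^ 2) (ν : PMF (List (Vec n ⧸ doubleLattice L))) :
    (mixtureOf (cosetGaussian L s) ν).map (pairAndAverage L) =
      mixtureOf (cosetGaussian L s') (nextCosets L s ν) := by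
  have h := funext (bind_averageCosetLaw (L := L) hs hs' hss)
  rw [mixtureOf, PMF.map_bind, mixtureOf, nextCosets, PMF.bind_bind, PMF.bind_map]
  congr 1
  funext c
  rw [map_pairAndAverage_independentList fun q x hx => cosetOf_eq_of_mem_support hs hx, ← h,
    independentList_map_bind]
  rfl

theorem mem_of_mem_pairedList {α : Type*} [DecidableEq α] {x : α} {l : List α}
    (h : x ∈ pairedList l) : x ∈ l := by
  rw [← List.count_pos_iff, count_pairedList] at h
  rw [← List.count_pos_iff]
  omega

theorem isShiftCoset_of_mem_support_nextCosets [DiscreteTopology L] (hs : 0 < s) (hs' : 0 < s')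
    (hss : s ^ 2 = 2 * s' ^ 2) {ν : PMF (List (Vec n ⧸ doubleLattice L))}
    (hν : ∀ c ∈ ν.support, ∀ q ∈ c, IsShiftCoset L t q) :
    ∀ c ∈ (nextCosets L s ν).support, ∀ q ∈ c, IsShiftCoset L t q := by
  classical
  intro c hc q hq
  obtain ⟨l, hl, hc⟩ := (PMF.mem_support_bind_iff _ _ _).1 hc
  obtain ⟨l', hl', rfl⟩ := (PMF.mem_support_map_iff _ _ _).1 hl
  have h := mem_support_independentList hc
  rw [List.forall₂_map_right_iff] at h
  obtain ⟨i, hi, rfl⟩ := List.mem_iff_getElem.1 hq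
  have hi' : i < (pairedList l').length := by rw [← h.length_eq]; exact hi
  exact isShiftCoset_of_mem_support_averageCosetLaw hs hs' hss
    (hν _ hl' _ (mem_of_mem_pairedList (List.getElem_mem hi'))) (h.get hi hi')

end Mixture

/-! ### Real inequalities between the masses -/

section MassInequalities

variable {n : ℕ} {L : Submodule ℤ (Vec n)} {t : Vec n} {s s' : ℝ}

theorem isShiftCoset_sub (c : L) : IsShiftCoset L t (cosetOf L ((c : Vec n) - t)) :=
  isShiftCoset_cosetOf.2 (by simp [shiftedLattice])

theorem collisionMass_toReal_pos : 0 < (collisionMass L t s).toReal :=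
  ENNReal.toReal_pos collisionMass_ne_zero collisionMass_ne_top

theorem squaredLaw_toReal (q : Vec n ⧸ doubleLattice L) :
    (squaredLaw L t s q).toReal * (collisionMass L t s).toReal =
      (shiftLaw L t s q).toReal ^ 2 := by
  rw [squaredLaw_apply, ENNReal.toReal_mul, ENNReal.toReal_inv, ENNReal.toReal_pow,
    inv_mul_cancel_right₀ collisionMass_toReal_pos.ne']

variable [DiscreteTopology L]

theorem gaussianMassSet_cosetSet_le (hs : 0 < s) {q : Vec n ⧸ doubleLattice L}
    (hq : IsShiftCoset L t q) :
    gaussianMassSet s (cosetSet L q) ≤ gaussianMassSet s (shiftedLattice L t) := by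
  rw [gaussianMassSet_eq_toReal, gaussianMassSet_eq_toReal]
  exact ENNReal.toReal_mono (gMassSet_ne_top hs le_rfl)
    (gMassSet_mono (cosetSet_subset_shiftedLattice hq))

theorem gaussianMassSet_cosetSet_le_max (hs : 0 < s) {q : Vec n ⧸ doubleLattice L}
    (hq : IsShiftCoset L t q) : gaussianMassSet s (cosetSet L q) ≤ maxCosetMass L t s := by
  obtain ⟨x, hx, rfl⟩ := hq
  have hbdd : BddAbove (Set.range fun c : L =>
      gaussianMassSet s (cosetSet L (cosetOf L ((c : Vec n) - t)))) := by
    refine ⟨gaussianMassSet s (shiftedLattice L t), ?_⟩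
    rintro _ ⟨c, rfl⟩
    exact gaussianMassSet_cosetSet_le hs (isShiftCoset_sub c)
  have := le_ciSup hbdd (⟨x + t, hx⟩ : L)
  simpa [maxCosetMass] using this

theorem maxCosetMass_le (hs : 0 < s) :
    maxCosetMass L t s ≤ gaussianMassSet s (shiftedLattice L t) :=
  ciSup_le fun c => gaussianMassSet_cosetSet_le hs (isShiftCoset_sub c)

theorem gaussianMassSet_pos (hs : 0 < s) {A : Set (Vec n)} (hne : A.Nonempty)
    (hA : A ⊆ shiftedLattice L t) : 0 < gaussianMassSet s A := by
  rw [gaussianMassSet_eq_toReal]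
  exact ENNReal.toReal_pos (gMassSet_ne_zero hne) (gMassSet_ne_top hs hA)

theorem gaussianMassSet_shiftedLattice_pos (hs : 0 < s) :
    0 < gaussianMassSet s (shiftedLattice L t) :=
  gaussianMassSet_pos hs shiftedLattice_nonempty le_rfl

theorem gMassSet_lattice_ne_top (hs : 0 < s) : gMassSet s (L : Set (Vec n)) ≠ ∞ :=
  gMassSet_ne_top (L := L) (t := 0) hs fun x hx => by simpa [shiftedLattice] using hx

theorem maxCosetMass_pos (hs : 0 < s) : 0 < maxCosetMass L t s :=
  (gaussianMassSet_pos hs (cosetSet_nonempty _)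
    (cosetSet_subset_shiftedLattice (isShiftCoset_sub (0 : L)))).trans_le
      (gaussianMassSet_cosetSet_le_max hs (isShiftCoset_sub (0 : L)))

/-- `gMassSet_sq_le` with `B` the largest coset mass for s'. The square root lets the bound pass
through the supremum. -/
theorem maxCosetMass_sq_le (hs : 0 < s) (hs' : 0 < s') (hss : s ^ 2 = 2 * s' ^ 2) :
    maxCosetMass L t s ^ 2 ≤ gaussianMassSet s' (L : Set (Vec n)) * maxCosetMass L t s' := by
  have hle : ∀ c : L, gaussianMassSet s (cosetSet L (cosetOf L ((c : Vec n) - t))) ≤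
      √(gaussianMassSet s' (L : Set (Vec n)) * maxCosetMass L t s') := by
    intro c
    refine Real.le_sqrt_of_sq_le ?_
    have h := gMassSet_sq_le hs hs' hss (isShiftCoset_sub (t := t) c)
      (B := ENNReal.ofReal (maxCosetMass L t s')) fun d hd => by
        refine (ENNReal.le_ofReal_iff_toReal_le (gMassSet_cosetSet_ne_top hs' _)
          (maxCosetMass_pos hs').le).2 ?_
        rw [← gaussianMassSet_eq_toReal]
        exact gaussianMassSet_cosetSet_le_max hs' hd
    have h2 := ENNReal.toReal_mono
      (ENNReal.mul_ne_top (gMassSet_lattice_ne_top hs') ENNReal.ofReal_ne_top) h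
    rwa [ENNReal.toReal_pow, ENNReal.toReal_mul, ENNReal.toReal_ofReal (maxCosetMass_pos hs').le,
      ← gaussianMassSet_eq_toReal, ← gaussianMassSet_eq_toReal] at h2
  have h0 : 0 ≤ gaussianMassSet s' (L : Set (Vec n)) * maxCosetMass L t s' := by
    rw [gaussianMassSet_eq_toReal]
    exact mul_nonneg ENNReal.toReal_nonneg (maxCosetMass_pos hs').le
  calc maxCosetMass L t s ^ 2
      ≤ √(gaussianMassSet s' (L : Set (Vec n)) * maxCosetMass L t s') ^ 2 :=
        pow_le_pow_left₀ (maxCosetMass_pos hs).le (ciSup_le hle) 2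
    _ = _ := Real.sq_sqrt h0

/-- The largest probability of a coset. -/
def maxCosetProb (L : Submodule ℤ (Vec n)) (t : Vec n) (s : ℝ) : ℝ :=
  maxCosetMass L t s / gaussianMassSet s (shiftedLattice L t)

theorem maxCosetProb_pos (hs : 0 < s) : 0 < maxCosetProb L t s :=
  div_pos (maxCosetMass_pos hs) (gaussianMassSet_shiftedLattice_pos hs)

theorem maxCosetProb_le_one (hs : 0 < s) : maxCosetProb L t s ≤ 1 :=
  div_le_one_of_le₀ (maxCosetMass_le hs) (gaussianMassSet_shiftedLattice_pos hs).le

theorem shiftLaw_toReal_le (hs : 0 < s) (q : Vec n ⧸ doubleLattice L) :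
    (shiftLaw L t s q).toReal ≤ maxCosetProb L t s := by
  classical
  rw [shiftLaw_apply hs]
  split_ifs with hq
  · rw [ENNReal.toReal_mul, ENNReal.toReal_inv, ← gaussianMassSet_eq_toReal,
      ← gaussianMassSet_eq_toReal, ← div_eq_mul_inv]
    exact div_le_div_of_nonneg_right (gaussianMassSet_cosetSet_le_max hs hq)
      (gaussianMassSet_shiftedLattice_pos hs).le
  · exact (maxCosetProb_pos hs).le

theorem collisionMass_toReal_le (hs : 0 < s) :
    (collisionMass L t s).toReal ≤ maxCosetProb L t s := by
  refine ENNReal.toReal_le_of_le_ofReal (maxCosetProb_pos hs).le ?_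
  calc collisionMass L t s
      ≤ ∑' q, ENNReal.ofReal (maxCosetProb L t s) * shiftLaw L t s q := by
        refine ENNReal.tsum_le_tsum fun q => ?_
        rw [sq]
        refine mul_le_mul_left ?_ _
        exact (ENNReal.le_ofReal_iff_toReal_le (PMF.apply_ne_top _ _)
          (maxCosetProb_pos hs).le).2 (shiftLaw_toReal_le hs q)
    _ = _ := by rw [ENNReal.tsum_mul_left, PMF.tsum_coe, mul_one]

theorem collisionMass_toReal_eq (hs : 0 < s) (hs' : 0 < s') (hss : s ^ 2 = 2 * s' ^ 2) :
    (collisionMass L t s).toReal = gaussianMassSet s' (shiftedLattice L t) *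
      gaussianMassSet s' (L : Set (Vec n)) / gaussianMassSet s (shiftedLattice L t) ^ 2 := by
  have h := congrArg ENNReal.toReal (bind_squaredLaw_aux (t := t) (L := L) hs hs' hss).1
  simp only [ENNReal.toReal_mul, ENNReal.toReal_pow, ENNReal.toReal_inv,
    ← gaussianMassSet_eq_toReal, ENNReal.toReal_one] at h
  have h1 := collisionMass_toReal_pos (L := L) (t := t) (s := s)
  have h2 := gaussianMassSet_shiftedLattice_pos (L := L) (t := t) hs
  field_simp at h ⊢
  linarith

/-- This identifies the ratio in the statement with the factor S / qm that governs one round in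
`coupledUpTo_iidList`. -/
theorem massRatio_eq (hs : 0 < s) (hs' : 0 < s') (hss : s ^ 2 = 2 * s' ^ 2) :
    massRatio L t s s' = (collisionMass L t s).toReal / maxCosetProb L t s := by
  have h1 := maxCosetMass_pos (L := L) (t := t) hs
  have h2 := gaussianMassSet_shiftedLattice_pos (L := L) (t := t) hs
  rw [massRatio, collisionMass_toReal_eq hs hs' hss, maxCosetProb]
  field_simp

theorem massRatio_pos (hs : 0 < s) (hs' : 0 < s') (hss : s ^ 2 = 2 * s' ^ 2) :
    0 < massRatio L t s s' := by
  rw [massRatio_eq hs hs' hss]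
  exact div_pos collisionMass_toReal_pos (maxCosetProb_pos hs)

theorem massRatio_le_one (hs : 0 < s) (hs' : 0 < s') (hss : s ^ 2 = 2 * s' ^ 2) :
    massRatio L t s s' ≤ 1 := by
  rw [massRatio_eq hs hs' hss]
  exact div_le_one_of_le₀ (collisionMass_toReal_le hs) (maxCosetProb_pos hs).le

/-- A form of `maxCosetMass_sq_le`: what a round loses in the number of samples is regained, up to
32κ, in the largest coset probability. -/
theorem maxCosetProb_le_massRatio_mul (hs : 0 < s) (hs' : 0 < s') (hss : s ^ 2 = 2 * s' ^ 2) :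
    maxCosetProb L t s ≤ massRatio L t s s' * maxCosetProb L t s' := by
  have h1 := maxCosetMass_pos (L := L) (t := t) hs
  have h2 := gaussianMassSet_shiftedLattice_pos (L := L) (t := t) hs
  have h3 := gaussianMassSet_shiftedLattice_pos (L := L) (t := t) hs'
  have h4 := maxCosetMass_sq_le (L := L) (t := t) hs hs' hss
  rw [massRatio, maxCosetProb, maxCosetProb]
  calc maxCosetMass L t s / gaussianMassSet s (shiftedLattice L t)
      = maxCosetMass L t s ^ 2 /
        (gaussianMassSet s (shiftedLattice L t) * maxCosetMass L t s) := by field_simp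
    _ ≤ (gaussianMassSet s' (L : Set (Vec n)) * maxCosetMass L t s') /
        (gaussianMassSet s (shiftedLattice L t) * maxCosetMass L t s) := by gcongr
    _ = _ := by field_simp

end MassInequalities

/-! ### Iterating the rounds -/

section Iteration

variable {n : ℕ} {L : Submodule ℤ (Vec n)} {t : Vec n} {s κ : ℝ} {M ℓ : ℕ}

/-- The Gaussian parameter after `i` rounds. -/
def roundParam (s : ℝ) (i : ℕ) : ℝ := s / 2 ^ ((i : ℝ) / 2)

theorem roundParam_pos (hs : 0 < s) (i : ℕ) : 0 < roundParam s i :=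
  div_pos hs (by positivity)

theorem roundParam_zero : roundParam s 0 = s := by simp [roundParam]

theorem roundParam_succ_sq (i : ℕ) : roundParam s i ^ 2 = 2 * roundParam s (i + 1) ^ 2 := by
  have h : ∀ j : ℕ, ((2 : ℝ) ^ ((j : ℝ) / 2)) ^ 2 = 2 ^ j := fun j => by
    rw [← Real.rpow_natCast, ← Real.rpow_mul (by norm_num), ← Real.rpow_natCast]
    congr 1
    push_cast
    ring
  rw [roundParam, roundParam, div_pow, div_pow, h, h, pow_succ]
  ring

/-- The coset law of the output after `i` rounds. -/
def roundCosets (L : Submodule ℤ (Vec n)) (t : Vec n) (s : ℝ) (M : ℕ) :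
    ℕ → PMF (List (Vec n ⧸ doubleLattice L))
  | 0 => iidList M (shiftLaw L t s)
  | i + 1 => nextCosets L (roundParam s i) (roundCosets L t s M i)

/-- The number of target samples after `i` rounds, before rounding up. -/
def roundCount (L : Submodule ℤ (Vec n)) (t : Vec n) (s κ : ℝ) (M i : ℕ) : ℝ :=
  (M : ℝ) / (32 * κ) ^ i *
    ∏ j ∈ Finset.range i, massRatio L t (roundParam s j) (roundParam s (j + 1))

theorem roundCount_zero : roundCount L t s κ M 0 = M := by simp [roundCount]

theorem roundCount_succ (hκ : 0 < κ) (i : ℕ) : roundCount L t s κ M (i + 1) =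
    roundCount L t s κ M i * massRatio L t (roundParam s i) (roundParam s (i + 1)) /
      (32 * κ) := by
  rw [roundCount, roundCount, Finset.prod_range_succ, pow_succ]
  field_simp

theorem outputCount_eq (i : ℕ) : outputCount L t s κ M i = ⌈roundCount L t s κ M i⌉₊ := by
  rw [outputCount, roundCount]
  simp only [roundParam, Nat.cast_add, Nat.cast_one]

variable [DiscreteTopology L]

theorem map_iterate_pairAndAverage (hs : 0 < s) (i : ℕ) :
    (iidList M (discreteGaussian s (shiftedLattice L t))).map ((pairAndAverage L)^[i]) =
      mixtureOf (cosetGaussian L (roundParam s i)) (roundCosets L t s M i) := by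
  induction i with
  | zero =>
    rw [Function.iterate_zero, PMF.map_id, roundParam_zero, iidList_discreteGaussian hs]
    rfl
  | succ i ih =>
    rw [Function.iterate_succ', ← PMF.map_comp, ih,
      map_pairAndAverage_mixtureOf (roundParam_pos hs i) (roundParam_pos hs (i + 1))
        (roundParam_succ_sq i)]
    rfl

theorem isShiftCoset_of_mem_support_iidList (hs : 0 < s) :
    ∀ c ∈ (iidList M (shiftLaw L t s)).support, ∀ q ∈ c, IsShiftCoset L t q :=
  fun _ hc _ hq => support_shiftLaw hs ((mem_support_iidList hc).2 _ hq)

theorem isShiftCoset_of_mem_support_roundCosets (hs : 0 < s) (i : ℕ) :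
    ∀ c ∈ (roundCosets L t s M i).support, ∀ q ∈ c, IsShiftCoset L t q := by
  induction i with
  | zero => exact isShiftCoset_of_mem_support_iidList hs
  | succ i ih =>
    exact isShiftCoset_of_mem_support_nextCosets (roundParam_pos hs i)
      (roundParam_pos hs (i + 1)) (roundParam_succ_sq i) ih

theorem roundCount_nonneg (hs : 0 < s) (hκ : 0 < κ) (i : ℕ) : 0 ≤ roundCount L t s κ M i :=
  mul_nonneg (by positivity) (Finset.prod_nonneg fun j _ =>
    (massRatio_pos (roundParam_pos hs j) (roundParam_pos hs (j + 1)) (roundParam_succ_sq j)).le)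

theorem roundCount_succ_le (hs : 0 < s) (hκ : 10 ≤ κ) (i : ℕ) :
    roundCount L t s κ M (i + 1) ≤ roundCount L t s κ M i := by
  have h0 := roundCount_nonneg (L := L) (t := t) (M := M) hs (show 0 < κ by linarith) i
  rw [roundCount_succ (by linarith)]
  refine div_le_of_le_mul₀ (by linarith) h0 (mul_le_mul_of_nonneg_left ?_ h0)
  exact (massRatio_le_one (roundParam_pos hs i) (roundParam_pos hs (i + 1))
    (roundParam_succ_sq i)).trans (by linarith)

theorem roundCount_mul_le (hs : 0 < s) (hκ : 0 < κ) (i : ℕ) :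
    roundCount L t s κ M i * maxCosetProb L t (roundParam s i) ≤
      32 * κ * (roundCount L t s κ M (i + 1) * maxCosetProb L t (roundParam s (i + 1))) := by
  have h0 := roundCount_nonneg (L := L) (t := t) (M := M) hs hκ i
  rw [roundCount_succ hκ]
  calc _ ≤ roundCount L t s κ M i * (massRatio L t (roundParam s i) (roundParam s (i + 1)) *
        maxCosetProb L t (roundParam s (i + 1))) := by
        gcongr
        exact maxCosetProb_le_massRatio_mul (roundParam_pos hs i) (roundParam_pos hs (i + 1))
          (roundParam_succ_sq i)
    _ = _ := by field_simp

theorem pow_le_roundCount_mul (hs : 0 < s) (hκ : 10 ≤ κ)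
    (hM : (10 * κ) ^ (2 * ℓ) ≤ M * maxCosetProb L t s) {i : ℕ} (hi : i ≤ ℓ) :
    (10 * κ) ^ (2 * (ℓ - i)) ≤
      roundCount L t s κ M i * maxCosetProb L t (roundParam s i) := by
  induction i with
  | zero => simpa [roundCount_zero, roundParam_zero] using hM
  | succ i ih =>
    have h1 := ih (by omega)
    have h2 := h1.trans (roundCount_mul_le hs (by linarith) i)
    have h3 : (10 * κ) ^ (2 * (ℓ - i)) =
        (10 * κ) ^ 2 * (10 * κ) ^ (2 * (ℓ - (i + 1))) := by
      rw [← pow_add]; congr 1; omega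
    -- A round costs only 32κ, while the exponent 2ℓ of the hypothesis budgets (10κ)² for it.
    have h4 : (32 * κ) * (10 * κ) ^ (2 * (ℓ - (i + 1))) ≤
        (10 * κ) ^ 2 * (10 * κ) ^ (2 * (ℓ - (i + 1))) := by
      gcongr
      nlinarith
    rw [h3] at h2
    exact le_of_mul_le_mul_left (h4.trans h2) (by linarith)

open Classical in
theorem coupledUpTo_round (hs : 0 < s) (hκ : 10 ≤ κ)
    (hM : (10 * κ) ^ (2 * ℓ) ≤ M * maxCosetProb L t s) {i : ℕ} (hi : i < ℓ) :
    CoupledUpTo (ENNReal.ofReal (11 * M * Real.exp (-(15 / 100) * κ)))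
      (fun a b => ∀ x, 2 * b.count x ≤ a.count x)
      (iidList (outputCount L t s κ M i) (shiftLaw L t (roundParam s i)))
      (iidList (outputCount L t s κ M (i + 1)) (squaredLaw L t (roundParam s i))) := by
  have hκ0 : 0 < κ := by linarith
  have hsi := roundParam_pos hs i
  have hsi' := roundParam_pos hs (i + 1)
  have hss := roundParam_succ_sq (s := s) i
  have hq0 := maxCosetProb_pos (L := L) (t := t) hsi
  have hS0 := collisionMass_toReal_pos (L := L) (t := t) (s := roundParam s i)
  rw [outputCount_eq, outputCount_eq]
  have hanti : ∀ j, roundCount L t s κ M j ≤ M := by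
    intro j
    induction j with
    | zero => exact roundCount_zero.le
    | succ j ih => exact (roundCount_succ_le hs hκ j).trans ih
  have hMi : ⌈roundCount L t s κ M i⌉₊ ≤ M := Nat.ceil_le.2 (hanti i)
  have hlow : (10 * κ) ^ 2 ≤ roundCount L t s κ M i * maxCosetProb L t (roundParam s i) :=
    (pow_le_pow_right₀ (by linarith) (by omega)).trans (pow_le_roundCount_mul hs hκ hM hi.le)
  -- From (10κ)² ≤ 32κ times the next count, as coset probabilities are at most 1. In particular the
  -- next count is at least 1, so that rounding it up at most doubles it.
  have hnext : κ ≤ roundCount L t s κ M (i + 1) := by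
    have h1 := hlow.trans (roundCount_mul_le hs hκ0 i)
    have h2 : roundCount L t s κ M (i + 1) * maxCosetProb L t (roundParam s (i + 1)) ≤
        roundCount L t s κ M (i + 1) :=
      mul_le_of_le_one_right (roundCount_nonneg hs hκ0 _) (maxCosetProb_le_one hsi')
    have h3 : 32 * κ * κ ≤ 32 * κ * roundCount L t s κ M (i + 1) := by
      refine le_trans ?_ (h1.trans (mul_le_mul_of_nonneg_left h2 (by linarith)))
      nlinarith
    exact le_of_mul_le_mul_left h3 (by linarith)
  refine (coupledUpTo_iidList (κ := κ) (qm := maxCosetProb L t (roundParam s i))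
    (S := (collisionMass L t (roundParam s i)).toReal)
    ((finite_isShiftCoset (t := t)).subset (support_shiftLaw hsi)) hκ (shiftLaw_toReal_le hsi)
    hq0 hS0 squaredLaw_toReal ?_ ?_ (hnext.trans (Nat.le_ceil _))
    (Nat.ceil_mono (roundCount_succ_le hs hκ i))).mono ?_ fun _ _ h => h
  · calc 100 * κ ^ 2 = (10 * κ) ^ 2 := by ring
      _ ≤ _ := hlow
      _ ≤ _ := by gcongr; exact Nat.le_ceil _
  · calc (⌈roundCount L t s κ M (i + 1)⌉₊ : ℝ) ≤ roundCount L t s κ M (i + 1) + 1 :=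
          (Nat.ceil_lt_add_one (roundCount_nonneg hs hκ0 _)).le
      -- This doubling is the reason for 32κ in place of the 16κ of `coupledUpTo_iidList`.
      _ ≤ 2 * roundCount L t s κ M (i + 1) := by linarith
      _ = roundCount L t s κ M i * (collisionMass L t (roundParam s i)).toReal /
          (16 * κ * maxCosetProb L t (roundParam s i)) := by
        rw [roundCount_succ hκ0, massRatio_eq hsi hsi' hss]
        field_simp
        ring
      _ ≤ _ := by gcongr; exact Nat.le_ceil _
  · refine ENNReal.ofReal_le_ofReal ?_
    gcongr

/-- Pairing preserves the inclusion from the earlier rounds, and `coupledUpTo_round` places samples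
of the squared law inside the pairs. Drawing the new cosets preserves inclusion too and turns the
squared law into the coset law of the next parameter. -/
theorem coupledUpTo_roundCosets (hs : 0 < s) (hκ : 10 ≤ κ)
    (hM : (10 * κ) ^ (2 * ℓ) ≤ M * maxCosetProb L t s) {i : ℕ} (hi : i ≤ ℓ) :
    CoupledUpTo (ENNReal.ofReal (i * (11 * M * Real.exp (-(15 / 100) * κ))))
      (fun a b => b.Subperm a) (roundCosets L t s M i)
      (iidList (outputCount L t s κ M i) (shiftLaw L t (roundParam s i))) := by
  classical
  induction i with
  | zero =>
    rw [outputCount_eq, roundCount_zero, Nat.ceil_natCast, roundParam_zero, roundCosets]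
    simpa using CoupledUpTo.refl (R := fun a b => List.Subperm b a) List.Subperm.refl _
  | succ i ih =>
    have h1 := (ih (by omega)).map (R' := fun a b => b.Subperm a) (f := pairedList)
      (g := pairedList) fun a b h => h.pairedList
    have h2 := (coupledUpTo_round hs hκ hM (i := i) (by omega)).map
      (R' := fun a b => b.Subperm a) (f := pairedList) (g := id) fun a b h => by
        rw [id, List.subperm_iff_count]
        intro x
        rw [count_pairedList]
        have := h x
        omega
    rw [PMF.map_id] at h2
    have h3 := (h1.trans h2 (S := fun a b => b.Subperm a)
      fun a b c h h' => h'.trans h).bind_independentList (averageCosetLaw L (roundParam s i))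
    rw [← iidList_bind, bind_squaredLaw (roundParam_pos hs i) (roundParam_pos hs (i + 1))
      (roundParam_succ_sq i), ← ENNReal.ofReal_add (by positivity) (by positivity)] at h3
    refine CoupledUpTo.mono h3 (le_of_eq ?_) fun _ _ h => h
    congr 1
    push_cast
    ring

end Iteration

end

/-! ### The theorem: choice of constants and passage from couplings to domination -/

theorem corollaryB2 :
    ∃ C > (0 : ℝ), ∃ c > (0 : ℝ),
      ∀ (n : ℕ) (L : Submodule ℤ (Vec n)) [DiscreteTopology L] [IsZLattice ℝ L]
        (t : Vec n) (s : ℝ) (M ℓ : ℕ) (κ : ℝ),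
        0 < s → 2 ≤ M → 1 ≤ ℓ → C * Real.log M ≤ κ →
        (10 * κ) ^ (2 * ℓ) * (gaussianMassSet s (shiftedLattice L t) / maxCosetMass L t s) ≤ M →
        ∀ output : PMF (List (Vec n)),
          output = (iidList M (discreteGaussian s (shiftedLattice L t))).map
            ((pairAndAverage L)^[ℓ]) →
        ∀ target : PMF (List (Vec n)),
          target = iidList (outputCount L t s κ M ℓ)
            (discreteGaussian (s / 2 ^ ((ℓ : ℝ) / 2)) (shiftedLattice L t)) →
        IsGaussianMixture L t (s / 2 ^ ((ℓ : ℝ) / 2)) output ∧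
        (∃ output' : PMF (List (Vec n)),
          IsGaussianMixture L t (s / 2 ^ ((ℓ : ℝ) / 2)) output' ∧
          statDist output output' ≤ ℓ * Real.exp (-c * κ) ∧
          Dominates (cosetDistribution L output') (cosetDistribution L target)) ∧
        (∃ target' : PMF (List (Vec n)),
          IsGaussianMixture L t (s / 2 ^ ((ℓ : ℝ) / 2)) target' ∧
          statDist target target' ≤ ℓ * Real.exp (-c * κ) ∧
          Dominates (cosetDistribution L output) (cosetDistribution L target')) := by
  -- κ ≥ 100 log M gives 11M ≤ M⁵ ≤ exp((5/100) κ), which lowers the rate from 15/100 to 1/10. It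
  -- also gives κ ≥ 10, as M ≥ 2.
  refine ⟨100, by norm_num, 1 / 10, by norm_num, ?_⟩
  intro n L _ _ t s M ℓ κ hs hM2 _ hκM hM output houtput target htarget
  have hM2' : (2 : ℝ) ≤ M := by exact_mod_cast hM2
  have hlog : Real.log 2 ≤ Real.log M := Real.log_le_log (by norm_num) hM2'
  have hκ : 10 ≤ κ := by linarith [Real.log_two_gt_d9]
  have hsℓ : 0 < roundParam s ℓ := roundParam_pos hs ℓ
  have hM' : (10 * κ) ^ (2 * ℓ) ≤ M * maxCosetProb L t s := by
    have h1 := maxCosetMass_pos (L := L) (t := t) hs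
    have h2 := gaussianMassSet_shiftedLattice_pos (L := L) (t := t) hs
    rw [mul_div_assoc', div_le_iff₀ h1] at hM
    rw [maxCosetProb, mul_div_assoc', le_div_iff₀ h2]
    exact hM
  have herr : 11 * M * Real.exp (-(15 / 100) * κ) ≤ Real.exp (-(1 / 10) * κ) := by
    have hM5 : 11 * (M : ℝ) ≤ Real.exp (5 / 100 * κ) := by
      calc 11 * (M : ℝ) ≤ M ^ 5 := by
            have : (2 : ℝ) ^ 4 ≤ M ^ 4 := by gcongr
            nlinarith
        _ = Real.exp (5 * Real.log M) := by
            rw [mul_comm, Real.exp_mul, Real.exp_log (by linarith)]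
            exact_mod_cast rfl
        _ ≤ Real.exp (5 / 100 * κ) := Real.exp_le_exp.2 (by linarith)
    calc _ ≤ Real.exp (5 / 100 * κ) * Real.exp (-(15 / 100) * κ) := by gcongr
      _ = _ := by rw [← Real.exp_add]; ring_nf
  have hε : 0 ≤ ℓ * Real.exp (-(1 / 10) * κ) := by positivity
  have hcoup := (coupledUpTo_roundCosets hs hκ hM' le_rfl).mono (ENNReal.ofReal_le_ofReal
    (mul_le_mul_of_nonneg_left herr (Nat.cast_nonneg ℓ))) fun _ _ h => h
  have hsupp := isShiftCoset_of_mem_support_roundCosets (L := L) (t := t) (M := M) hs ℓ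
  have hsupp' := isShiftCoset_of_mem_support_iidList (L := L) (t := t)
    (M := outputCount L t s κ M ℓ) hsℓ
  rw [map_iterate_pairAndAverage hs] at houtput
  change target = iidList _ (discreteGaussian (roundParam s ℓ) _) at htarget
  rw [iidList_discreteGaussian hsℓ] at htarget
  change IsGaussianMixture L t (roundParam s ℓ) output ∧
    (∃ output', IsGaussianMixture L t (roundParam s ℓ) output' ∧ _) ∧
      ∃ target', IsGaussianMixture L t (roundParam s ℓ) target' ∧ _
  subst houtput htarget
  refine ⟨isGaussianMixture_mixtureOf hsℓ hsupp, ?_, ?_⟩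
  -- The coset list is altered, not the list of vectors, so that the new law is still a mixture;
  -- sampling inside the cosets does not increase the error.
  · obtain ⟨ν, h1, h2, h3⟩ := hcoup.exists_left (R := fun a b => List.Subperm b a) List.Subperm.refl
    refine ⟨mixtureOf (cosetGaussian L (roundParam s ℓ)) ν,
      isGaussianMixture_mixtureOf hsℓ fun c hc => ?_,
      statDist_le_of_coupledUpTo hε (h1.mixtureOf _), ?_⟩
    · rcases h3 hc with h | h
      · exact hsupp c h
      · exact hsupp' c h
    · rw [cosetDistribution_mixtureOf hsℓ, cosetDistribution_mixtureOf hsℓ]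
      exact dominates_of_coupledUpTo h2
  -- The reversed coupling alters the target instead of the output.
  · obtain ⟨ν, h1, h2, h3⟩ := hcoup.symm.exists_left List.Subperm.refl
    refine ⟨mixtureOf (cosetGaussian L (roundParam s ℓ)) ν,
      isGaussianMixture_mixtureOf hsℓ fun c hc => ?_,
      statDist_le_of_coupledUpTo hε (h1.mixtureOf _), ?_⟩
    · rcases h3 hc with h | h
      · exact hsupp' c h
      · exact hsupp c h
    · rw [cosetDistribution_mixtureOf hsℓ, cosetDistribution_mixtureOf hsℓ]
      exact dominates_of_coupledUpTo h2.symm
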